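/- Let $P$ be a connected link diagram in the oriented plane (possibly the crossingless diagram of the unknot), and let $$\langle P\rangle=\sum_{s}A^{a(s)-b(s)}\,(-A^2-A^{-2})^{|s|-1}\in\mathbb Z[A,A^{-1}]$$ be its Kauffman bracket, where $s$ runs over all assignments of an $A$- or $B$-splicing to each crossing, $a(s)$ and $b(s)$ are the numbers of $A$- and $B$-splicings, and $|s|$ is the number of circles of the spliced diagram. A *dessin* is a finite multigraph (loops, multiple edges and isolated vertices are allowed) with a cyclic order of the half-edges at each vertex. For a dessin $\mathbb D$ let $v(\mathbb D),e(\mathbb D),k(\mathbb D)$ be the numbers of vertices, edges and connected components, $f(\mathbb D)$ the number of faces (boundary components of the associated ribbon surface; an isolated vertex has one face), and $g(\mathbb D)=\tfrac12\big(2k(\mathbb D)-v(\mathbb D)+e(\mathbb D)-f(\mathbb D)\big)$ its genus. A *spanning sub-dessin* $\mathbb H\subset\mathbb D$ is obtained from $\mathbb D$ by deleting a (possibly empty) set of edges; it has the same vertices and the induced cyclic orders. Let $\mathbb H_0$ be the one without edges. Let $\mathbb D=\mathbb D(A)$ be the all-$A$ dessin of $P$: its vertices are the circles of the all-$A$ state,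 its edges are the crossings (each joining the circles on which its two spliced strands lie), and the half-edges at a vertex are cyclically ordered by running through the circle, clockwise if the circle lies inside an odd number of the other circles and anticlockwise if it lies inside an even number of them. For $l\ge 0$ let $a_{M-l}$ be the coefficient of $A^{e(\mathbb D)+2v(\mathbb D)-2-4l}$ in $\langle P\rangle$, and write $a_M=a_{M-0}$. For a spanning sub-dessin $\mathbb H\subset\mathbb D$ call $$X_{\mathbb H}=A^{e(\mathbb D)-2e(\mathbb H)}(-A^2-A^{-2})^{f(\mathbb H)-1}$$ its contribution. **Theorem.** 1. For every integer $l\ge0$, the coefficient $a_{M-l}$ depends only on the spanning sub-dessins $\mathbb H\subset\mathbb D$ of genus $g(\mathbb H)\le l$. Precisely: $a_{M-l}$ is the sum, over the spanning sub-dessins $\mathbb H$ with $g(\mathbb H)\le l$, of the coefficients of $A^{e(\mathbb D)+2v(\mathbb D)-2-4l}$ in $X_{\mathbb H}$, and this coefficient is $0$ for every $\mathbb H$ with $g(\mathbb H)>l$. In particular, if $P'$ is another connected link diagram with all-$A$ dessin $\mathbb D'$, and there is a bijection between the spanning sub-dessins of genus $\le l$ of $\mathbb D$ and those of $\mathbb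 D'$ under which corresponding sub-dessins are isomorphic, then $a_{M-l}(P)=a_{M-l}(P')$. 2. The highest term is $$a_M=\sum_{\mathbb H\subset\mathbb D,\ g(\mathbb H)=0,\ k(\mathbb H)=v(\mathbb D)}(-1)^{v(\mathbb D)+e(\mathbb H)-1}.$$ In particular, if $\mathbb D$ has no loops, then $a_M=(-1)^{v(\mathbb D)-1}$, and the only contribution comes from $\mathbb H_0$: it is the only spanning sub-dessin with $g(\mathbb H)=0$ and $k(\mathbb H)=v(\mathbb D)$, and for $\mathbb H\ne\mathbb H_0$ the coefficient of $A^{e(\mathbb D)+2v(\mathbb D)-2}$ in $X_{\mathbb H}$ is $0$. -/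

import Mathlib

/-! ## First return permutations -/

section FirstReturn

variable {α : Type*} [Finite α] (σ : Equiv.Perm α) (p : α → Prop)

theorem exists_return (x : {x // p x}) : ∃ n : ℕ, p ((σ ^ (n + 1)) x.1) := by
  refine ⟨orderOf σ - 1, ?_⟩
  have h : orderOf σ - 1 + 1 = orderOf σ := Nat.sub_add_cancel (orderOf_pos σ)
  rw [h, pow_orderOf_eq_one]
  exact x.2

open Classical in
/-- The first point with property `p` among `σ x, σ² x, …`. -/
noncomputable def firstReturnFun (x : {x // p x}) : {x // p x} :=
  ⟨(σ ^ (Nat.find (exists_return σ p x) + 1)) x.1, Nat.find_spec (exists_return σ p x)⟩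

theorem firstReturnFun_injective : Function.Injective (firstReturnFun σ p) := by
  classical
  have key : ∀ x y : {x // p x}, firstReturnFun σ p x = firstReturnFun σ p y →
      Nat.find (exists_return σ p x) ≤ Nat.find (exists_return σ p y) → x = y := by
    intro x y h hle
    obtain ⟨d, hd⟩ := Nat.exists_eq_add_of_le hle
    have h1 : (σ ^ (Nat.find (exists_return σ p x) + 1)) x.1 =
        (σ ^ (Nat.find (exists_return σ p y) + 1)) y.1 := congrArg Subtype.val h
    have h2 : x.1 = (σ ^ d) y.1 := by
      apply (σ ^ (Nat.find (exists_return σ p x) + 1)).injective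
      rw [h1, ← Equiv.Perm.mul_apply, ← pow_add, hd]
      congr 2
      omega
    rcases d with _ | d
    · exact Subtype.ext (by simpa using h2)
    · exfalso
      have h3 : p ((σ ^ (d + 1)) y.1) := h2 ▸ x.2
      have h4 := Nat.find_min' (exists_return σ p y) h3
      omega
  intro x y h
  rcases le_total (Nat.find (exists_return σ p x)) (Nat.find (exists_return σ p y)) with hl | hl
  · exact key x y h hl
  · exact (key y x h.symm hl).symm

/-- The permutation of the points with property `p` obtained from `σ` by skipping all other
points in its cycles. -/
noncomputable def firstReturn : Equiv.Perm {x // p x} :=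
  Equiv.ofBijective (firstReturnFun σ p)
    (Finite.injective_iff_bijective.mp (firstReturnFun_injective σ p))

theorem firstReturn_sameCycle (x y : {x // p x}) :
    (firstReturn σ p).SameCycle x y ↔ σ.SameCycle x.1 y.1 := by
  classical
  have step : ∀ z : {x // p x}, σ.SameCycle z.1 (firstReturn σ p z).1 := fun z =>
    ⟨((Nat.find (exists_return σ p z) + 1 : ℕ) : ℤ), rfl⟩
  constructor
  · intro h
    obtain ⟨n, hn⟩ := h.exists_nat_pow_eq
    have : ∀ n : ℕ, σ.SameCycle x.1 (((firstReturn σ p) ^ n) x).1 := by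
      intro n
      induction n with
      | zero => exact Equiv.Perm.SameCycle.refl _ _
      | succ n ih =>
        rw [pow_succ', Equiv.Perm.mul_apply]
        exact ih.trans (step _)
    exact hn ▸ this n
  · intro h
    obtain ⟨n, hn⟩ := h.exists_nat_pow_eq
    clear h
    induction n using Nat.strong_induction_on generalizing x with
    | _ n ih =>
      rcases n with _ | n
      · have : x = y := Subtype.ext (by simpa using hn)
        exact this ▸ Equiv.Perm.SameCycle.refl _ _
      · have hle : Nat.find (exists_return σ p x) ≤ n :=
          Nat.find_min' (exists_return σ p x) (hn ▸ y.2)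
        have h1 : (firstReturn σ p).SameCycle (firstReturn σ p x) y := by
          apply ih (n - Nat.find (exists_return σ p x)) (by omega)
          change (σ ^ (n - Nat.find (exists_return σ p x)))
            ((σ ^ (Nat.find (exists_return σ p x) + 1)) x.1) = y.1
          rw [← Equiv.Perm.mul_apply, ← pow_add, ← hn]
          congr 2
          omega
        exact (Equiv.Perm.sameCycle_apply_left).mp h1

end FirstReturn

/-! ## Dessins d'enfant -/

/-- A dessin with vertex set `V` and edge set `E`: a multigraph (loops and multiple edges are
allowed) with a cyclic order of the half-edges at every vertex. The edge `e` has the two half-edges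
`(e, false)` and `(e, true)`; `rot` maps a half-edge to the next one at the same vertex.
Vertices without half-edges are allowed. -/
structure Dessin (V E : Type*) where
  vert : E × Bool → V
  rot : Equiv.Perm (E × Bool)
  rot_sameCycle : ∀ h h' : E × Bool, rot.SameCycle h h' ↔ vert h = vert h'

namespace Dessin

variable {V E V' E' : Type*}

/-- The other half of the same edge. -/
def flip (h : E × Bool) : E × Bool := (h.1, !h.2)

/-- The faces: the boundary walks along half-edges, and one face for each isolated vertex. -/
abbrev Face (D : Dessin V E) : Type _ :=
  Quot (fun h h' : E × Bool => h' = D.rot (flip h)) ⊕ {v : V // v ∉ Set.range D.vert}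

/-- The number of vertices. -/
noncomputable def v (_ : Dessin V E) : ℕ := Nat.card V

/-- The number of edges. -/
noncomputable def e (_ : Dessin V E) : ℕ := Nat.card E

/-- The number of faces. -/
noncomputable def f (D : Dessin V E) : ℕ := Nat.card D.Face

/-- The number of connected components. -/
noncomputable def k (D : Dessin V E) : ℕ :=
  Nat.card (Quot (fun x y : V => ∃ a : E, x = D.vert (a, false) ∧ y = D.vert (a, true)))

/-- The genus (as a rational number, so that nothing is rounded). -/
noncomputable def genus (D : Dessin V E) : ℚ :=
  (2 * (D.k : ℚ) - D.v + D.e - D.f) / 2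

/-- The edge `a` is a loop. -/
def IsLoop (D : Dessin V E) (a : E) : Prop := D.vert (a, false) = D.vert (a, true)

/-- The spanning sub-dessin with edge set `H`: all other edges are deleted, all vertices are kept,
and the remaining half-edges at each vertex keep their cyclic order. -/
noncomputable def sub [Finite E] (D : Dessin V E) (H : Finset E) : Dessin V {a // a ∈ H} where
  vert h := D.vert (h.1.1, h.2)
  rot := (Equiv.prodSubtypeFstEquivSubtypeProd (p := fun a : E => a ∈ H)).permCongr
    (firstReturn D.rot (fun h : E × Bool => h.1 ∈ H))
  rot_sameCycle := by
    intro h h'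
    rw [← D.rot_sameCycle]
    set φ := Equiv.prodSubtypeFstEquivSubtypeProd (p := fun a : E => a ∈ H) (β := Bool)
    have h1 := firstReturn_sameCycle D.rot (fun h : E × Bool => h.1 ∈ H) (φ.symm h) (φ.symm h')
    have h2 : ∀ (n : ℤ) z, ((φ.permCongr (firstReturn D.rot (fun h : E × Bool => h.1 ∈ H))) ^ n) z
        = φ (((firstReturn D.rot (fun h : E × Bool => h.1 ∈ H)) ^ n) (φ.symm z)) := by
      intro n z
      have h3 := map_zpow φ.permCongrHom (firstReturn D.rot (fun h : E × Bool => h.1 ∈ H)) n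
      exact (congrArg (fun τ : Equiv.Perm _ => τ z) h3).symm
    refine Iff.trans ?_ h1
    constructor
    · rintro ⟨n, hn⟩
      exact ⟨n, by rw [h2] at hn; rw [← hn, φ.symm_apply_apply]⟩
    · rintro ⟨n, hn⟩
      exact ⟨n, by rw [h2, hn, φ.apply_symm_apply]⟩

/-- Isomorphisms of dessins: graph isomorphisms that preserve the cyclic orders. -/
structure Iso (D : Dessin V E) (D' : Dessin V' E') where
  vertEquiv : V ≃ V'
  halfEquiv : E × Bool ≃ E' × Bool
  map_flip : ∀ h, halfEquiv (flip h) = flip (halfEquiv h)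
  map_vert : ∀ h, D'.vert (halfEquiv h) = vertEquiv (D.vert h)
  map_rot : ∀ h, halfEquiv (D.rot h) = D'.rot (halfEquiv h)

open LaurentPolynomial in
/-- The term `A ^ (e(D) - 2 e(H)) * (-A² - A⁻²) ^ (f(H) - 1)` of the spanning sub-dessin `H` in the
spanning sub-dessin expansion. -/
noncomputable def contribution [Finite E] (D : Dessin V E) (H : Finset E) : LaurentPolynomial ℤ :=
  T ((D.e : ℤ) - 2 * ((D.sub H).e : ℤ)) * (-T 2 - T (-2)) ^ ((D.sub H).f - 1)

end Dessin

/-! ## Link diagrams and the Kauffman bracket -/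

/-- A connected link diagram in the oriented plane, up to planar isotopy, with set of crossings `C`.

The four ends ("darts") at the crossing `c` are `(c, 0), (c, 1), (c, 2), (c, 3)` in anticlockwise
order, where `(c, 0)` and `(c, 2)` belong to the under-strand, `(c, 1)` and `(c, 3)` to the
over-strand. The arcs of the diagram join the darts in pairs, by the involution `arc`.

The pair `(c, i)` also denotes the corner at `c` between the darts `(c, i)` and `(c, i + 1)`.
The region that has the corner `(c, i)` has as its next corner the one which precedes the dart
`arc (c, i)` in the anticlockwise order (we walk along the arc and keep the region to the left).
As the diagram is connected, its regions are the cycles of this permutation of the corners, and it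
is planar if its Euler characteristic, with `2 * #C` arcs, is 2. The set `outer` consists of the
corners of the unbounded region.

If `C` is empty, the structure stands for the crossingless diagram, one simple closed curve. -/
structure ConnectedDiagram (C : Type*) [Fintype C] where
  arc : Equiv.Perm (C × ZMod 4)
  arc_arc : ∀ d, arc (arc d) = d
  arc_ne : ∀ d, arc d ≠ d
  connected : Subsingleton (Quot (fun x y : C × ZMod 4 => y = arc x ∨ y.1 = x.1))
  planar : Nonempty C →
    Nat.card (Quot (fun x y : C × ZMod 4 => y = ((arc x).1, (arc x).2 - 1))) = Fintype.card C + 2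
  outer : Set (C × ZMod 4)
  outer_region : Nonempty C → ∃ x, outer =
    {y | Quot.mk (fun x y : C × ZMod 4 => y = ((arc x).1, (arc x).2 - 1)) y = Quot.mk _ x}

/-- At every crossing, the `A`-splicing joins the darts 0 and 1, and the darts 2 and 3 (it merges
the two regions swept out by the over-strand when it is turned anticlockwise), and the
`B`-splicing joins 1 and 2, and 3 and 0. A state is given by the set `s` of the crossings with
`B`-splicing; `spliceFun s` is the involution of the darts that it defines. -/
def spliceFun {C : Type*} [DecidableEq C] (s : Finset C) (d : C × ZMod 4) : C × ZMod 4 :=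
  if d.1 ∈ s then (d.1, if d.2 = 0 ∨ d.2 = 2 then d.2 - 1 else d.2 + 1)
  else (d.1, if d.2 = 0 ∨ d.2 = 2 then d.2 + 1 else d.2 - 1)

theorem spliceFun_involutive {C : Type*} [DecidableEq C] (s : Finset C) :
    Function.Involutive (spliceFun s) := by
  rintro ⟨c, i⟩
  by_cases h : c ∈ s
  · simp only [spliceFun, h, if_true, Prod.mk.injEq, true_and]
    revert i; decide
  · simp only [spliceFun, h, if_false, Prod.mk.injEq, true_and]
    revert i; decide

theorem spliceFun_ne {C : Type*} [DecidableEq C] (s : Finset C) (d : C × ZMod 4) :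
    spliceFun s d ≠ d := by
  obtain ⟨c, i⟩ := d
  by_cases h : c ∈ s
  · simp only [spliceFun, h, if_true, ne_eq, Prod.mk.injEq, true_and]
    revert i; decide
  · simp only [spliceFun, h, if_false, ne_eq, Prod.mk.injEq, true_and]
    revert i; decide

/-- The involution of the darts given by the splicings of the state `s`. -/
def splice {C : Type*} [DecidableEq C] (s : Finset C) : Equiv.Perm (C × ZMod 4) :=
  (spliceFun_involutive s).toPerm

theorem splice_splice {C : Type*} [DecidableEq C] (s : Finset C) (d : C × ZMod 4) :
    splice s (splice s d) = d :=
  spliceFun_involutive s d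

namespace ConnectedDiagram

variable {C : Type*} [Fintype C] [DecidableEq C] (P : ConnectedDiagram C)

/-- The circles of the state `s` that pass through crossings. -/
abbrev Circle (s : Finset C) : Type _ :=
  Quot (fun x y : C × ZMod 4 => y = P.arc x ∨ y = splice s x)

/-- All circles of the state `s`: if there is no crossing, the diagram itself is the only one. -/
abbrev StateCircle (s : Finset C) : Type _ := P.Circle s ⊕ PLift (IsEmpty C)

/-- The circle through a dart. -/
def circle (s : Finset C) (d : C × ZMod 4) : P.Circle s := Quot.mk _ d

open LaurentPolynomial in
/-- The Kauffman bracket, with value 1 on the crossingless diagram of the unknot: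
`⟨P⟩ = ∑ₛ A ^ (a(s) - b(s)) * (-A² - A⁻²) ^ (|s| - 1)`, summed over all states `s`, with `a(s)`
`A`-splicings, `b(s)` `B`-splicings and `|s|` circles. -/
noncomputable def bracket : LaurentPolynomial ℤ :=
  ∑ s : Finset C, T (((sᶜ).card : ℤ) - (s.card : ℤ)) *
    (-T 2 - T (-2)) ^ (Nat.card (P.StateCircle s) - 1)

/-! ### The orientation of the circles of the all-`A` state -/

/-- The moves between corners which do not cross the circle `γ` of the all-`A` state: to the next
corner of the same region; through the channel that the `A`-splicing opens between the corners 1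
and 3 of a crossing; across a dart which does not lie on `γ`. -/
inductive Move (γ : P.Circle ∅) : C × ZMod 4 → C × ZMod 4 → Prop
  | region (x : C × ZMod 4) : Move γ x ((P.arc x).1, (P.arc x).2 - 1)
  | channel (c : C) : Move γ (c, 1) (c, 3)
  | cross (x : C × ZMod 4) (h : P.circle ∅ x ≠ γ) : Move γ x (x.1, x.2 - 1)

/-- The corner `x` lies inside the circle `γ`: the complement of `γ` contains no path from the
unbounded region to `x`. -/
def Inside (γ : P.Circle ∅) (x : C × ZMod 4) : Prop :=
  ∀ o ∈ P.outer, ¬ Relation.EqvGen (P.Move γ) o x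

/-- Some dart on the circle `γ`. -/
noncomputable def someDart (γ : P.Circle ∅) : C × ZMod 4 := Quot.out γ

/-- The number of circles that the circle `γ` is inside of. -/
noncomputable def depth (γ : P.Circle ∅) : ℕ :=
  Nat.card {γ' : P.Circle ∅ // γ' ≠ γ ∧ P.Inside γ' (P.someDart γ)}

open Classical in
/-- A dart of `γ` through which `γ` enters a crossing when it is oriented anticlockwise, that is,
with its inside to the left. (To the left of the way into a crossing through the dart `(c, i)` is
the corner `(c, i - 1)`; in the opposite direction, the circle enters through the dart that is
joined to `(c, i)` by the splicing.) -/
noncomputable def anticlockwiseDart (γ : P.Circle ∅) : C × ZMod 4 :=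
  if P.Inside γ ((P.someDart γ).1, (P.someDart γ).2 - 1) then P.someDart γ
  else splice ∅ (P.someDart γ)

open Classical in
/-- A dart through which `γ` enters a crossing, when `γ` is oriented clockwise or anticlockwise
according to whether it is inside an odd or an even number of circles. -/
noncomputable def orientedDart (γ : P.Circle ∅) : C × ZMod 4 :=
  if Even (P.depth γ) then P.anticlockwiseDart γ else splice ∅ (P.anticlockwiseDart γ)

/-- Travelling along the circles of the all-`A` state, from the dart of entry into a crossing
to the dart of entry into the next one. -/
def travel : Equiv.Perm (C × ZMod 4) := P.arc * splice ∅

/-- The oriented circles of the all-`A` state enter a crossing through the dart `d`. -/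
def Entry (d : C × ZMod 4) : Prop := P.travel.SameCycle (P.orientedDart (P.circle ∅ d)) d

theorem travel_splice_zpow (n : ℤ) (d : C × ZMod 4) :
    splice ∅ ((P.travel ^ n) d) = (P.travel ^ (-n)) (splice ∅ d) := by
  have h1 : (splice ∅ : Equiv.Perm (C × ZMod 4)) * splice ∅ = 1 :=
    Equiv.ext (fun d => spliceFun_involutive ∅ d)
  have h2 : P.arc * P.arc = 1 := Equiv.ext P.arc_arc
  have h3 : splice ∅ * P.travel * (splice ∅)⁻¹ = P.travel⁻¹ := by
    rw [travel, mul_inv_rev, inv_eq_of_mul_eq_one_right h1, inv_eq_of_mul_eq_one_right h2,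
      mul_assoc, mul_assoc, h1, mul_one]
  have h4 : splice ∅ * P.travel ^ n * (splice ∅)⁻¹ = P.travel ^ (-n) := by
    rw [← conj_zpow, h3, inv_zpow, zpow_neg]
  have h5 := congrArg (fun τ : Equiv.Perm (C × ZMod 4) => τ (splice ∅ d)) h4
  simpa using h5

theorem not_sameCycle_splice (d : C × ZMod 4) : ¬ P.travel.SameCycle d (splice ∅ d) := by
  rintro ⟨n, hn⟩
  rcases Int.even_or_odd' n with ⟨m, rfl | rfl⟩
  · apply spliceFun_ne ∅ ((P.travel ^ m) d)
    change splice ∅ ((P.travel ^ m) d) = _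
    rw [travel_splice_zpow, ← hn, ← Equiv.Perm.mul_apply, ← zpow_add]
    congr 2
    ring
  · apply P.arc_ne (splice ∅ ((P.travel ^ m) d))
    change P.travel ((P.travel ^ m) d) = _
    rw [travel_splice_zpow, ← hn, ← Equiv.Perm.mul_apply, ← Equiv.Perm.mul_apply, ← zpow_add,
      ← zpow_one_add]
    congr 2
    ring

theorem sameCycle_splice {d d' : C × ZMod 4} (h : P.travel.SameCycle d d') :
    P.travel.SameCycle (splice ∅ d) (splice ∅ d') := by
  obtain ⟨n, rfl⟩ := h
  exact ⟨-n, (P.travel_splice_zpow n d).symm⟩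

theorem circle_splice (s : Finset C) (d : C × ZMod 4) :
    P.circle s (splice s d) = P.circle s d :=
  (Quot.sound (r := fun x y : C × ZMod 4 => y = P.arc x ∨ y = splice s x) (Or.inr rfl)).symm

theorem circle_travel (d : C × ZMod 4) : P.circle ∅ (P.travel d) = P.circle ∅ d :=
  (Quot.sound (r := fun x y : C × ZMod 4 => y = P.arc x ∨ y = splice ∅ x)
    (Or.inl rfl)).symm.trans (P.circle_splice ∅ d)

theorem circle_eq_of_sameCycle {d d' : C × ZMod 4} (h : P.travel.SameCycle d d') :
    P.circle ∅ d = P.circle ∅ d' := by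
  obtain ⟨n, rfl⟩ := h.exists_nat_pow_eq
  clear h
  induction n with
  | zero => rfl
  | succ n ih => rw [pow_succ', Equiv.Perm.mul_apply, circle_travel, ← ih]

theorem circle_eq_iff (d d' : C × ZMod 4) : P.circle ∅ d = P.circle ∅ d' ↔
    P.travel.SameCycle d d' ∨ P.travel.SameCycle (splice ∅ d) d' := by
  constructor
  · intro h
    have h' := Quot.eqvGen_exact h
    clear h
    induction h' with
    | rel x y h =>
      rcases h with rfl | rfl
      · right
        refine ⟨1, ?_⟩
        simp [travel, splice_splice]
      · right
        exact Equiv.Perm.SameCycle.refl _ _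
    | refl x => exact Or.inl (Equiv.Perm.SameCycle.refl _ _)
    | symm x y _ ih =>
      rcases ih with h | h
      · exact Or.inl h.symm
      · right
        have := P.sameCycle_splice h
        rw [splice_splice] at this
        exact this.symm
    | trans x y z _ _ ih1 ih2 =>
      rcases ih1 with h1 | h1 <;> rcases ih2 with h2 | h2
      · exact Or.inl (h1.trans h2)
      · exact Or.inr ((P.sameCycle_splice h1).trans h2)
      · exact Or.inr (h1.trans h2)
      · left
        have := P.sameCycle_splice h1
        rw [splice_splice] at this
        exact this.trans h2
  · rintro (h | h)
    · exact P.circle_eq_of_sameCycle h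
    · rw [← P.circle_eq_of_sameCycle h, circle_splice]

theorem circle_orientedDart (γ : P.Circle ∅) : P.circle ∅ (P.orientedDart γ) = γ := by
  have h : P.circle ∅ (P.someDart γ) = γ := Quot.out_eq γ
  unfold orientedDart anticlockwiseDart
  split_ifs <;> simp only [circle_splice, h]

theorem entry_splice (d : C × ZMod 4) : P.Entry (splice ∅ d) ↔ ¬ P.Entry d := by
  unfold Entry
  rw [circle_splice]
  constructor
  · intro h1 h2
    exact P.not_sameCycle_splice d (h2.symm.trans h1)
  · intro h1
    rcases (P.circle_eq_iff _ _).mp (P.circle_orientedDart (P.circle ∅ d)) with h | h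
    · exact absurd h h1
    · have := P.sameCycle_splice h
      rwa [splice_splice] at this

theorem entry_travel (d : C × ZMod 4) : P.Entry d ↔ P.Entry (P.travel d) := by
  unfold Entry
  rw [circle_travel, Equiv.Perm.sameCycle_apply_right]

/-- The crossing `c` is spliced into two pieces, the one that joins the darts 0 and 1, called
`(c, false)`, and the one that joins the darts 2 and 3, called `(c, true)`. This is the piece to
which a dart belongs. -/
def piece (d : C × ZMod 4) : C × Bool := (d.1, decide (d.2 = 2 ∨ d.2 = 3))

theorem piece_eq_iff (d d' : C × ZMod 4) :
    piece d = piece d' ↔ d' = d ∨ d' = splice ∅ d := by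
  obtain ⟨c, i⟩ := d
  obtain ⟨c', i'⟩ := d'
  have h : (splice ∅ : Equiv.Perm (C × ZMod 4)) (c, i) =
      (c, if i = 0 ∨ i = 2 then i + 1 else i - 1) := by
    change spliceFun ∅ (c, i) = _
    simp [spliceFun]
  rw [h]
  clear h
  simp only [piece, Prod.mk.injEq, ← and_or_left, eq_comm (a := c)]
  refine and_congr_right (fun _ => ?_)
  have key : ∀ i i' : ZMod 4, decide (i = 2 ∨ i = 3) = decide (i' = 2 ∨ i' = 3) ↔
      i' = i ∨ i' = if i = 0 ∨ i = 2 then i + 1 else i - 1 := by decide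
  exact key i i'

/-- Each piece of a spliced crossing has exactly one dart of entry. -/
noncomputable def entryEquiv : {d // P.Entry d} ≃ C × Bool :=
  Equiv.ofBijective (fun d => piece d.1) <| by
    constructor
    · intro d d' h
      rcases (piece_eq_iff _ _).mp h with h | h
      · exact Subtype.ext h.symm
      · exact absurd d.2 ((P.entry_splice d.1).mp (h ▸ d'.2))
    · rintro ⟨c, b⟩
      obtain ⟨i, hi⟩ : ∃ i : ZMod 4, decide (i = 2 ∨ i = 3) = b := by
        revert b; decide
      by_cases h : P.Entry (c, i)
      · exact ⟨⟨_, h⟩, Prod.ext rfl hi⟩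
      · refine ⟨⟨_, (P.entry_splice _).mpr h⟩, ?_⟩
        exact ((piece_eq_iff (c, i) (splice ∅ (c, i))).mpr (Or.inr rfl)).symm.trans
          (Prod.ext rfl hi)

theorem circle_eq_iff_of_entry (d d' : {d // P.Entry d}) :
    P.circle ∅ d.1 = P.circle ∅ d'.1 ↔ P.travel.SameCycle d.1 d'.1 := by
  constructor
  · intro h
    have h1 := d.2
    have h2 := d'.2
    unfold Entry at h1 h2
    rw [← h] at h2
    exact h1.symm.trans h2
  · exact P.circle_eq_of_sameCycle

theorem circle_piece (d : C × ZMod 4) :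
    P.circle ∅ ((piece d).1, if (piece d).2 then 2 else 0) = P.circle ∅ d := by
  have h : piece d = piece ((piece d).1, if (piece d).2 then (2 : ZMod 4) else 0) := by
    refine Prod.ext rfl ?_
    obtain ⟨c, i⟩ := d
    have key : ∀ i : ZMod 4, decide (i = 2 ∨ i = 3) =
        decide ((if decide (i = 2 ∨ i = 3) then (2 : ZMod 4) else 0) = 2 ∨
          (if decide (i = 2 ∨ i = 3) then (2 : ZMod 4) else 0) = 3) := by decide
    exact key i
  rcases (piece_eq_iff _ _).mp h with h | h
  · rw [h]
  · rw [h, circle_splice]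

/-- The dessin `𝔻(A)`. Its vertices are the circles of the all-`A` state, its edges are the
crossings, the half-edges of a crossing are attached to the circles at the two pieces into which
the crossing is spliced, and they are cyclically ordered by the orientation of the circles. -/
noncomputable def dessin : Dessin (P.StateCircle ∅) C where
  vert h := Sum.inl (P.circle ∅ (h.1, if h.2 then 2 else 0))
  rot := P.entryEquiv.permCongr (P.travel.subtypePerm (fun d => (P.entry_travel d).symm))
  rot_sameCycle := by
    intro h h'
    obtain ⟨d, rfl⟩ := P.entryEquiv.surjective h
    obtain ⟨d', rfl⟩ := P.entryEquiv.surjective h'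
    have hd : ∀ d : {d // P.Entry d}, P.circle ∅ ((P.entryEquiv d).1,
        if (P.entryEquiv d).2 then 2 else 0) = P.circle ∅ d.1 := fun d => P.circle_piece d.1
    rw [hd, hd, Sum.inl.injEq, circle_eq_iff_of_entry, ← Equiv.Perm.sameCycle_subtypePerm
      (h := fun d => (P.entry_travel d).symm)]
    set τ := P.travel.subtypePerm (p := P.Entry) (fun d => (P.entry_travel d).symm)
    have h2 : ∀ (n : ℤ) z, ((P.entryEquiv.permCongr τ) ^ n) (P.entryEquiv z)
        = P.entryEquiv ((τ ^ n) z) := by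
      intro n z
      have h3 := map_zpow P.entryEquiv.permCongrHom τ n
      have h4 := (congrArg (fun τ : Equiv.Perm _ => τ (P.entryEquiv z)) h3).symm
      simpa using h4
    constructor
    · rintro ⟨n, hn⟩
      exact ⟨n, P.entryEquiv.injective (by rw [← h2, hn])⟩
    · rintro ⟨n, hn⟩
      exact ⟨n, by rw [h2, hn]⟩

/-- The exponent `e(𝔻) + 2 v(𝔻) - 2`. -/
noncomputable def topExponent : ℤ := (P.dessin.e : ℤ) + 2 * (P.dessin.v : ℤ) - 2

/-- The coefficient `a_{M-l}` of `A ^ (e(𝔻) + 2 v(𝔻) - 2 - 4 l)` in the Kauffman bracket. -/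
noncomputable def a (l : ℕ) : ℤ := P.bracket.coeff (P.topExponent - 4 * (l : ℤ))

end ConnectedDiagram

/-!
The proof compares the circles of a state with the faces of a sub-dessin, and then reads off degrees.

**The circles of the state `H` are the faces of the sub-dessin `H`** (`card_stateCircle`), where `H`
is the set of crossings with a `B`-splicing. The ribbon surface of the dessin is obtained from discs
spanned by the circles of the all-`A` state by attaching one band for each crossing, and the
`B`-splicing follows the sides of the band. This needs the bands to be untwisted for the chosen
orientations: at every crossing, the circles run along the channel opened by the `A`-splicing in
opposite directions (`entry_zero_iff_entry_two`). With the given orientations, the corner to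
the left of a circle lies inside an odd number of circles and the one to its right inside an
even number (`entry_iff_odd_enclosing`); the two corners in the channel of a crossing are on the
same side of every circle, hence the claim.

The parity statement rests on the Jordan curve theorem for the circles (`inside_turn_iff`). A circle
has at most two sides because the diagram is connected (`sameSide_or`). It has two because the
diagram, seen as a dessin with the crossings as vertices, has genus 0: by a dimension count modulo 2,
`f - k ≤ rank ∂₂ ≤ dim ker ∂₁ ≤ e - v + k` holds in every dessin, and if the outer terms agree, then
every cycle is the boundary of a set of faces (`Dessin.exists_faceBoundary_eq`), which colours
the two sides of the circle differently (`exists_coloring`, `not_sameSide_turn`). The same count shows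
that no genus is negative (`Dessin.genus_nonneg`).

**Degrees.** Hence the bracket is the sum of the contributions of all sub-dessins
(`bracket_eq_sum_contribution`). The highest exponent in the contribution of `H` is
`e(D) + 2 v(D) - 2 - 4 (v(D) - k(H)) - 4 g(H)`, with coefficient `(-1) ^ (f(H) - 1)`, where `k(H) ≤ v(D)`
(`Dessin.coeff_contribution_eq_zero`, `Dessin.coeff_contribution_top`). So only the sub-dessins with
`g(H) ≤ l` reach the exponent `e(D) + 2 v(D) - 2 - 4 l`, and for `l = 0` only those with `g(H) = 0` and
`k(H) = v(D)`, all of whose edges are loops.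
-/

/-! ### Genus and the homology of a dessin with coefficients in `ZMod 2` -/

/-- A space of functions that factor through `c : X → Y` has dimension at most `#Y`. -/
theorem finrank_le_card_of_factorsThrough {K X Y : Type*} [Field K] [Finite X] [Finite Y]
    (c : X → Y) (p : Submodule K (X → K)) (h : ∀ g ∈ p, ∀ a b, c a = c b → g a = g b) :
    Module.finrank K p ≤ Nat.card Y := by
  have := Fintype.ofFinite Y
  have h1 : p ≤ LinearMap.range (LinearMap.funLeft K K c) := by
    intro g hg
    obtain ⟨y, hy⟩ := (Function.factorsThrough_iff (f := c) g).mp (fun a b => h g hg a b)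
    exact ⟨y, hy.symm⟩
  calc Module.finrank K p ≤ _ := Submodule.finrank_mono h1
    _ ≤ Module.finrank K (Y → K) := LinearMap.finrank_range_le _
    _ = Nat.card Y := by rw [Module.finrank_fintype_fun_eq_card, Nat.card_eq_fintype_card]

theorem ZMod.two_add_eq_zero_iff (a b : ZMod 2) : a + b = 0 ↔ a = b := by
  revert a b; decide

namespace Dessin

variable {V E : Type*}

/-- The connected components. -/
abbrev Component (D : Dessin V E) : Type _ :=
  Quot (fun x y : V => ∃ a : E, x = D.vert (a, false) ∧ y = D.vert (a, true))

theorem vert_rot (D : Dessin V E) (h : E × Bool) : D.vert (D.rot h) = D.vert h :=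
  ((D.rot_sameCycle h (D.rot h)).mp ⟨1, rfl⟩).symm

theorem flip_flip (h : E × Bool) : flip (flip h) = h := by
  simp [flip]

theorem component_vert_flip (D : Dessin V E) (h : E × Bool) :
    (Quot.mk _ (D.vert (flip h)) : D.Component) = Quot.mk _ (D.vert h) := by
  obtain ⟨a, _ | _⟩ := h
  · exact (Quot.sound ⟨a, rfl, rfl⟩).symm
  · exact Quot.sound ⟨a, rfl, rfl⟩

/-- The face to the side of a half-edge. -/
def face (D : Dessin V E) (h : E × Bool) : D.Face := Sum.inl (Quot.mk _ h)

theorem face_rot (D : Dessin V E) (h : E × Bool) : D.face (D.rot h) = D.face (flip h) :=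
  congrArg Sum.inl (Quot.sound (by rw [flip_flip])).symm

/-- The connected component on which a face lies. -/
def faceComponent (D : Dessin V E) : D.Face → D.Component :=
  Sum.elim
    (Quot.lift (fun h => Quot.mk _ (D.vert h)) (by
      rintro h _ rfl
      rw [vert_rot, component_vert_flip]))
    (fun v => Quot.mk _ v.1)

/-- The boundary map from chains of faces to chains of edges, modulo 2: the edge `a` occurs as often
as a face lies on one of its two sides. -/
def faceBoundary (D : Dessin V E) : (D.Face → ZMod 2) →ₗ[ZMod 2] (E → ZMod 2) where
  toFun g a := g (D.face (a, false)) + g (D.face (a, true))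
  map_add' g g' := by
    funext a
    simp only [Pi.add_apply]
    ring
  map_smul' r g := by
    funext a
    simp only [Pi.smul_apply, smul_eq_mul, RingHom.id_apply]
    ring

open Classical in
/-- The incidence matrix modulo 2. A loop is not incident to its vertex. -/
noncomputable def incidence (D : Dessin V E) : Matrix E V (ZMod 2) :=
  Matrix.of fun a x => (if D.vert (a, false) = x then 1 else 0) +
    (if D.vert (a, true) = x then 1 else 0)

theorem incidence_mulVec [Fintype V] (D : Dessin V E) (g : V → ZMod 2) (a : E) :
    D.incidence.mulVec g a = g (D.vert (a, false)) + g (D.vert (a, true)) := by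
  classical
  simp [Matrix.mulVec, dotProduct, incidence, add_mul, Finset.sum_add_distrib]

open Classical in
theorem incidence_transpose_mulVec [Fintype E] (D : Dessin V E) (z : E → ZMod 2) (x : V) :
    D.incidence.transpose.mulVec z x = ∑ h : E × Bool with D.vert h = x, z h.1 := by
  rw [Finset.sum_filter, Fintype.sum_prod_type]
  simp only [Matrix.mulVec, dotProduct, incidence, Matrix.transpose_apply, Matrix.of_apply,
    Fintype.sum_bool]
  refine Finset.sum_congr rfl fun a _ => ?_
  split_ifs <;> ring

theorem finrank_ker_incidence_le [Fintype V] (D : Dessin V E) :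
    Module.finrank (ZMod 2) (LinearMap.ker D.incidence.mulVecLin) ≤ D.k := by
  refine finrank_le_card_of_factorsThrough (Quot.mk _ : V → D.Component) _ fun g hg => ?_
  have hg0 : ∀ a, g (D.vert (a, false)) = g (D.vert (a, true)) := fun a =>
    (ZMod.two_add_eq_zero_iff _ _).mp <| by
      rw [← incidence_mulVec]
      exact congrFun (LinearMap.mem_ker.mp hg) a
  let u : D.Component → ZMod 2 := Quot.lift g (by
    rintro _ _ ⟨a, rfl, rfl⟩
    exact hg0 a)
  exact fun a b hab => congrArg u hab

theorem faceBoundary_apply_fst (D : Dessin V E) (g : D.Face → ZMod 2) (h : E × Bool) :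
    D.faceBoundary g h.1 = g (D.face h) + g (D.face (D.rot h)) := by
  rw [face_rot]
  obtain ⟨a, _ | _⟩ := h
  · rfl
  · rw [add_comm]; rfl

/-- The boundary of a chain of faces is a cycle. -/
theorem range_faceBoundary_le [Fintype E] (D : Dessin V E) :
    LinearMap.range D.faceBoundary ≤ LinearMap.ker D.incidence.transpose.mulVecLin := by
  classical
  rintro _ ⟨g, rfl⟩
  rw [LinearMap.mem_ker]
  funext x
  rw [Matrix.mulVecLin_apply, incidence_transpose_mulVec]
  simp only [faceBoundary_apply_fst, Finset.sum_add_distrib, Pi.zero_apply, ZMod.two_add_eq_zero_iff]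
  refine (Finset.sum_equiv D.rot (fun h => ?_) (fun h _ => rfl)).symm
  simp [vert_rot]

variable [Finite V] [Finite E] (D : Dessin V E)

/-- A function on the faces with zero boundary is constant on the faces of every connected
component. -/
theorem finrank_ker_faceBoundary_le :
    Module.finrank (ZMod 2) (LinearMap.ker D.faceBoundary) ≤ D.k := by
  refine finrank_le_card_of_factorsThrough D.faceComponent _ fun g hg => ?_
  have hg0 : ∀ a, g (D.face (a, false)) = g (D.face (a, true)) := fun a =>
    (ZMod.two_add_eq_zero_iff _ _).mp (congrFun (LinearMap.mem_ker.mp hg) a)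
  have hflip : ∀ h, g (D.face (flip h)) = g (D.face h) := by
    rintro ⟨a, _ | _⟩
    · exact (hg0 a).symm
    · exact hg0 a
  have hrot : ∀ h h', D.vert h = D.vert h' → g (D.face h) = g (D.face h') := by
    intro h h' hv
    obtain ⟨n, rfl⟩ := ((D.rot_sameCycle h h').mpr hv).exists_nat_pow_eq
    clear hv
    induction n with
    | zero => rfl
    | succ n ih => rw [pow_succ', Equiv.Perm.mul_apply, face_rot, hflip, ih]
  classical
  -- the value of `g` on the faces at a vertex
  let w : V → ZMod 2 := fun x =>
    if hx : x ∈ Set.range D.vert then g (D.face hx.choose) else g (Sum.inr ⟨x, hx⟩)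
  have hw : ∀ h, w (D.vert h) = g (D.face h) := by
    intro h
    have hx : D.vert h ∈ Set.range D.vert := ⟨h, rfl⟩
    simp only [w, hx, dif_pos]
    exact hrot _ _ hx.choose_spec
  let u : D.Component → ZMod 2 := Quot.lift w (by
    rintro _ _ ⟨a, rfl, rfl⟩
    rw [hw, hw, hg0])
  have hu : ∀ a, g a = u (D.faceComponent a) := by
    rintro (a | x)
    · induction a using Quot.ind with
      | _ h => exact (hw h).symm
    · change _ = w x.1
      simp only [w, dif_neg x.2]
  intro a b hab
  rw [hu, hu, hab]

/-- The space of cycles has dimension at most `e - v + k`. -/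
theorem finrank_cycles_le [Fintype V] [Fintype E] :
    Module.finrank (ZMod 2) (LinearMap.ker D.incidence.transpose.mulVecLin) + D.v ≤
      D.e + D.k := by
  have h1 := LinearMap.finrank_range_add_finrank_ker D.incidence.mulVecLin
  have h2 := LinearMap.finrank_range_add_finrank_ker D.incidence.transpose.mulVecLin
  have h3 := D.finrank_ker_incidence_le
  have h4 := D.incidence.rank_transpose
  simp only [Matrix.rank] at h4
  rw [Module.finrank_fintype_fun_eq_card] at h1 h2
  simp only [v, e, Nat.card_eq_fintype_card]
  omega

theorem f_le_finrank_range_add_k :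
    D.f ≤ Module.finrank (ZMod 2) (LinearMap.range D.faceBoundary) + D.k := by
  have := Fintype.ofFinite D.Face
  have h1 := LinearMap.finrank_range_add_finrank_ker D.faceBoundary
  have h2 := D.finrank_ker_faceBoundary_le
  rw [Module.finrank_fintype_fun_eq_card] at h1
  simp only [f, Nat.card_eq_fintype_card]
  omega

theorem f_add_v_le : D.f + D.v ≤ 2 * D.k + D.e := by
  have := Fintype.ofFinite V
  have := Fintype.ofFinite E
  have h1 := D.f_le_finrank_range_add_k
  have h2 := D.finrank_cycles_le
  have h3 := Submodule.finrank_mono D.range_faceBoundary_le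
  omega

theorem genus_nonneg : 0 ≤ D.genus := by
  have h : (D.f : ℚ) + D.v ≤ 2 * D.k + D.e := by exact_mod_cast D.f_add_v_le
  unfold genus
  linarith

open Classical in
/-- In genus 0, every cycle is a boundary: the first homology group vanishes. -/
theorem exists_faceBoundary_eq [Fintype E] (hD : 2 * D.k + D.e ≤ D.f + D.v) (z : E → ZMod 2)
    (hz : ∀ x, ∑ h : E × Bool with D.vert h = x, z h.1 = 0) : ∃ g, D.faceBoundary g = z := by
  have := Fintype.ofFinite V
  have h1 := D.f_le_finrank_range_add_k
  have h2 := D.finrank_cycles_le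
  have h3 := Submodule.eq_of_le_of_finrank_le D.range_faceBoundary_le (by omega)
  have h4 : z ∈ LinearMap.range D.faceBoundary := by
    rw [h3, LinearMap.mem_ker]
    funext x
    rw [Matrix.mulVecLin_apply, incidence_transpose_mulVec, hz]
    rfl
  exact h4

end Dessin

/-! ### The Jordan curve theorem for the circles of a state -/

theorem sameCycle_permCongr {X Y : Type*} (ε : X ≃ Y) (σ : Equiv.Perm X) (x y : X) :
    (ε.permCongr σ).SameCycle (ε x) (ε y) ↔ σ.SameCycle x y := by
  refine exists_congr fun n => ?_
  have h1 : (ε.permCongr σ ^ n) (ε x) = ε ((σ ^ n) x) := by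
    have h2 := congrArg (fun τ : Equiv.Perm Y => τ (ε x)) (map_zpow ε.permCongrHom σ n)
    simpa using h2.symm
  rw [h1, ε.apply_eq_iff_eq]

/-- The points of a finite set with a free involution are the halves of its orbits. -/
theorem exists_equiv_prod_bool {X : Type*} [Finite X] (α : X → X) (h1 : ∀ x, α (α x) = x)
    (h2 : ∀ x, α x ≠ x) :
    ∃ (E : Type) (_ : Fintype E) (ε : E × Bool ≃ X), ∀ h, ε (Dessin.flip h) = α (ε h) := by
  obtain ⟨n, ⟨ν⟩⟩ := Finite.exists_equiv_fin X
  let E := {i : Fin n // i < ν (α (ν.symm i))}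
  let F : E × Bool → X := fun h => if h.2 then α (ν.symm h.1.1) else ν.symm h.1.1
  have hF : Function.Bijective F := by
    constructor
    · have key : ∀ i j : E, ν.symm i.1 ≠ α (ν.symm j.1) := by
        intro i j h
        have hi := i.2
        have hj := j.2
        rw [h, h1, ν.apply_symm_apply] at hi
        rw [← h, ν.apply_symm_apply] at hj
        exact lt_asymm hi hj
      rintro ⟨i, _ | _⟩ ⟨j, _ | _⟩ h
      · have : i = j := Subtype.ext (ν.symm.injective h)
        rw [this]
      · exact absurd h (key i j)
      · exact absurd h.symm (key j i)
      · have h3 : α (ν.symm i.1) = α (ν.symm j.1) := h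
        have : i = j := Subtype.ext (ν.symm.injective (by rw [← h1 (ν.symm i.1), h3, h1]))
        rw [this]
    · intro x
      rcases lt_trichotomy (ν x) (ν (α x)) with h | h | h
      · exact ⟨(⟨ν x, by rwa [ν.symm_apply_apply]⟩, false), ν.symm_apply_apply x⟩
      · exact absurd (ν.injective h).symm (h2 x)
      · refine ⟨(⟨ν (α x), by rwa [ν.symm_apply_apply, h1]⟩, true), ?_⟩
        change α (ν.symm (ν (α x))) = x
        rw [ν.symm_apply_apply, h1]
  refine ⟨E, inferInstance, Equiv.ofBijective F hF, ?_⟩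
  rintro ⟨i, _ | _⟩
  · rfl
  · exact (h1 _).symm

theorem forall_zmod_four_iff {p : ZMod 4 → Prop} (h : ∀ i, p i ↔ p (i - 1)) (i j : ZMod 4) :
    p i ↔ p j := by
  have h0 : ∀ i, p i ↔ p 0 := by
    have e1 : p 1 ↔ p 0 := h 1
    have e2 : p 2 ↔ p 1 := h 2
    have e3 : p 3 ↔ p 2 := h 3
    intro i
    fin_cases i
    · exact Iff.rfl
    · exact e1
    · exact e2.trans e1
    · exact e3.trans (e2.trans e1)
  rw [h0 i, h0 j]

/-- The rotation from a dart to the next one at the same crossing, in clockwise order. As corners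
carry the names of darts, the dart `d` lies between the corners `turn d` and `d`. When a curve comes
into a crossing through `d`, it has `turn d` to its left and `d` to its right. -/
def turn {C : Type*} : Equiv.Perm (C × ZMod 4) :=
  (Equiv.refl C).prodCongr (Equiv.subRight 1)

theorem turn_sameCycle {C : Type*} [Finite C] (x y : C × ZMod 4) :
    (turn : Equiv.Perm (C × ZMod 4)).SameCycle x y ↔ x.1 = y.1 := by
  constructor
  · intro h
    obtain ⟨n, rfl⟩ := h.exists_nat_pow_eq
    clear h
    induction n with
    | zero => rfl
    | succ n ih => rw [pow_succ', Equiv.Perm.mul_apply]; exact ih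
  · obtain ⟨c, i⟩ := x
    obtain ⟨c', j⟩ := y
    rintro rfl
    exact (forall_zmod_four_iff (p := fun j => turn.SameCycle (c, i) (c, j))
      (fun j => (Equiv.Perm.sameCycle_apply_right (f := turn) (y := (c, j))).symm) i j).mp
      (Equiv.Perm.SameCycle.refl _ _)

namespace ConnectedDiagram

variable {C : Type*} [Fintype C]

/-- The diagram itself as a dessin on the sphere: the vertices are the crossings, and the edges are
the arcs, whose ends are matched with the darts by `ε`. -/
def mapDessin {E : Type*} (ε : E × Bool ≃ C × ZMod 4) : Dessin C E where
  vert h := (ε h).1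
  rot := ε.symm.permCongr turn
  rot_sameCycle h h' := by
    have h1 := sameCycle_permCongr ε.symm turn (ε h) (ε h')
    rwa [ε.symm_apply_apply, ε.symm_apply_apply, turn_sameCycle] at h1

/-- The homology of the plane vanishes: if a set of arcs (given by its indicator function `z` on the
darts) has an even number of ends at every crossing, then the regions can be coloured with two
colours such that the colour changes exactly at these arcs. -/
theorem exists_coloring (P : ConnectedDiagram C) [Nonempty C] (z : C × ZMod 4 → ZMod 2)
    (hz : ∀ x, z (P.arc x) = z x) (hz0 : ∀ c, ∑ i, z (c, i) = 0) :
    ∃ g : C × ZMod 4 → ZMod 2, (∀ x, g (turn (P.arc x)) = g x) ∧ ∀ x, g x + g (turn x) = z x := by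
  classical
  obtain ⟨E, _, ε, hε⟩ := exists_equiv_prod_bool P.arc P.arc_arc P.arc_ne
  let D := mapDessin ε
  have hrot : ∀ h, ε (D.rot h) = turn (ε h) := fun h => by
    simp [D, mapDessin]
  have hf : D.f = Fintype.card C + 2 := by
    rw [← P.planar ‹_›]
    have : IsEmpty {c : C // c ∉ Set.range D.vert} := ⟨fun c => c.2 ⟨ε.symm (c.1, 0), by
      simp [D, mapDessin]⟩⟩
    refine Nat.card_congr ((Equiv.sumEmpty _ _).trans (Quot.congr ε fun h h' => ?_))
    rw [← ε.apply_eq_iff_eq, hrot, hε]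
    rfl
  have hk : D.k = 1 := by
    have h1 : Function.Surjective (fun c : C => (Quot.mk _ c : D.Component)) := Quot.mk_surjective
    have : Nonempty D.Component := Nonempty.map (Quot.mk _) ‹Nonempty C›
    have : Subsingleton D.Component := by
      let q : Quot (fun x y : C × ZMod 4 => y = P.arc x ∨ y.1 = x.1) → D.Component :=
        Quot.lift (fun x => Quot.mk _ x.1) (by
          rintro x y (rfl | h)
          · have h2 := D.component_vert_flip (ε.symm x)
            simp only [D, mapDessin, hε, ε.apply_symm_apply] at h2
            exact h2.symm
          · exact congrArg (Quot.mk _) h.symm)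
      have hq : Function.Surjective q := by
        intro a
        induction a using Quot.ind with
        | _ c => exact ⟨Quot.mk _ (c, 0), rfl⟩
      have := P.connected
      exact hq.subsingleton
    exact Nat.card_unique
  have he : D.e = 2 * Fintype.card C := by
    have h1 := Fintype.card_congr ε
    rw [Fintype.card_prod, Fintype.card_prod, Fintype.card_bool, ZMod.card] at h1
    simp only [Dessin.e, Nat.card_eq_fintype_card]
    omega
  have hv : D.v = Fintype.card C := Nat.card_eq_fintype_card
  have hz1 : ∀ h : E × Bool, z (ε (h.1, false)) = z (ε h) := by
    rintro ⟨a, _ | _⟩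
    · rfl
    · rw [← hz, ← hε]; rfl
  obtain ⟨g, hg⟩ := D.exists_faceBoundary_eq (by omega) (fun a => z (ε (a, false))) (by
    intro c
    simp only [hz1]
    rw [← hz0 c]
    refine Finset.sum_bij (fun h _ => (ε h).2) (fun _ _ => Finset.mem_univ _) ?_ ?_ ?_
    · intro h hh h' hh' heq
      simp only [Finset.mem_filter_univ] at hh hh'
      exact ε.injective (Prod.ext (hh.trans hh'.symm) heq)
    · intro i _
      exact ⟨ε.symm (c, i), by simp [D, mapDessin], by simp⟩
    · intro h hh
      simp only [Finset.mem_filter_univ] at hh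
      rw [← hh]
      rfl)
  refine ⟨fun x => g (D.face (ε.symm x)), fun x => ?_, fun x => ?_⟩
  · have h1 : ε.symm (turn (P.arc x)) = D.rot (Dessin.flip (ε.symm x)) := by
      rw [ε.symm_apply_eq, hrot, hε, ε.apply_symm_apply]
    change g (D.face (ε.symm (turn (P.arc x)))) = _
    rw [h1, D.face_rot, Dessin.flip_flip]
  · have h1 : ε.symm (turn x) = D.rot (ε.symm x) := by
      rw [ε.symm_apply_eq, hrot, ε.apply_symm_apply]
    change _ + g (D.face (ε.symm (turn x))) = _
    rw [h1, ← D.faceBoundary_apply_fst, hg]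
    change z (ε ((ε.symm x).1, false)) = z x
    rw [hz1, ε.apply_symm_apply]

variable [DecidableEq C] (P : ConnectedDiagram C) (γ : P.Circle ∅)

theorem circle_arc (s : Finset C) (x : C × ZMod 4) : P.circle s (P.arc x) = P.circle s x :=
  (Quot.sound (r := fun x y : C × ZMod 4 => y = P.arc x ∨ y = splice s x) (Or.inl rfl)).symm

/-- The corners `x` and `y` lie on the same side of the circle `γ`. -/
def SameSide (x y : C × ZMod 4) : Prop := Relation.EqvGen (P.Move γ) x y

variable {P γ}

theorem SameSide.refl (x : C × ZMod 4) : P.SameSide γ x x := Relation.EqvGen.refl x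

theorem SameSide.symm {x y : C × ZMod 4} (h : P.SameSide γ x y) : P.SameSide γ y x :=
  Relation.EqvGen.symm _ _ h

theorem SameSide.trans {x y z : C × ZMod 4} (h : P.SameSide γ x y) (h' : P.SameSide γ y z) :
    P.SameSide γ x z :=
  Relation.EqvGen.trans _ _ _ h h'

variable (P γ)

theorem sameSide_turn_arc (x : C × ZMod 4) : P.SameSide γ x (turn (P.arc x)) :=
  Relation.EqvGen.rel _ _ (Move.region x)

theorem sameSide_arc_turn (x : C × ZMod 4) : P.SameSide γ (P.arc x) (turn x) := by
  have h := P.sameSide_turn_arc γ (P.arc x)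
  rwa [P.arc_arc] at h

/-- A circle that passes a crossing keeps the corner to its left, or goes along the channel. -/
theorem sameSide_turn_splice (x : C × ZMod 4) : P.SameSide γ (turn x) (splice ∅ x) := by
  have h1 : P.SameSide γ (x.1, 1) (x.1, 3) := Relation.EqvGen.rel _ _ (Move.channel x.1)
  have h2 : splice ∅ x = (x.1, if x.2 = 0 ∨ x.2 = 2 then x.2 + 1 else x.2 - 1) := by
    change spliceFun ∅ x = _
    simp [spliceFun]
  rw [h2]
  obtain ⟨c, i⟩ := x
  fin_cases i
  · exact h1.symm
  · exact SameSide.refl _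
  · exact h1
  · exact SameSide.refl _

theorem sameSide_splice_turn (x : C × ZMod 4) : P.SameSide γ x (turn (splice ∅ x)) := by
  have h := P.sameSide_turn_splice γ (splice ∅ x)
  rw [splice_splice] at h
  exact h.symm

variable {γ} in
theorem sameSide_turn {x : C × ZMod 4} (h : P.circle ∅ x ≠ γ) : P.SameSide γ x (turn x) :=
  Relation.EqvGen.rel _ _ (Move.cross x h)

theorem sameSide_turn_travel (x : C × ZMod 4) :
    P.SameSide γ (turn x) (turn (P.travel x)) :=
  (P.sameSide_turn_splice γ x).trans (P.sameSide_turn_arc γ _)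

/-- The circle `γ` has at most two sides: it can be followed from one of its darts `d` to any other,
which keeps the corners on both sides of it on the sides of the corners at `d`; and since the diagram
is connected, all other corners can be reached from these. -/
theorem sameSide_or {d : C × ZMod 4} (hd : P.circle ∅ d = γ) (x : C × ZMod 4) :
    P.SameSide γ d x ∨ P.SameSide γ (turn d) x := by
  have mono : ∀ x y, P.SameSide γ x y → (P.SameSide γ d x ∨ P.SameSide γ (turn d) x) →
      (P.SameSide γ d y ∨ P.SameSide γ (turn d) y) := fun x y h =>
    Or.imp (fun h' => h'.trans h) (fun h' => h'.trans h)
  set S : C × ZMod 4 → Prop := fun x => P.SameSide γ d x ∨ P.SameSide γ (turn d) x with hS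
  have hiff : ∀ x y, P.SameSide γ x y → (S x ↔ S y) := fun x y h =>
    ⟨mono x y h, mono y x h.symm⟩
  -- both corners at a dart of `γ` are reached
  let T : P.Circle ∅ → Prop := Quot.lift (fun x => S x ∧ S (turn x)) (by
    rintro x y (rfl | rfl)
    · rw [hiff _ _ (P.sameSide_arc_turn γ x), hiff _ _ (P.sameSide_turn_arc γ x), and_comm]
    · rw [hiff _ _ (P.sameSide_turn_splice γ x), hiff _ _ (P.sameSide_splice_turn γ x), and_comm])
  have hT : ∀ x, P.circle ∅ x = γ → S x ∧ S (turn x) := by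
    intro x hx
    have h1 : T (P.circle ∅ d) := ⟨Or.inl (SameSide.refl _), Or.inr (SameSide.refl _)⟩
    rwa [hd, ← hx] at h1
  have hturn : ∀ x, S x ↔ S (turn x) := by
    intro x
    by_cases hx : P.circle ∅ x = γ
    · exact iff_of_true (hT x hx).1 (hT x hx).2
    · exact hiff _ _ (P.sameSide_turn hx)
  let U : Quot (fun x y : C × ZMod 4 => y = P.arc x ∨ y.1 = x.1) → Prop := Quot.lift S (by
    rintro x y (rfl | h)
    · rw [hturn (P.arc x), hiff _ _ (P.sameSide_turn_arc γ x)]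
    · obtain ⟨c, i⟩ := x
      obtain ⟨c', j⟩ := y
      obtain rfl : c' = c := h
      exact propext (forall_zmod_four_iff (p := fun i => S (c', i)) (fun i => hturn (c', i)) i j))
  have hU : U (Quot.mk _ d) := Or.inl (SameSide.refl _)
  have := P.connected
  rwa [Subsingleton.elim (Quot.mk _ d) (Quot.mk _ x)] at hU

/-- The circle `γ` has at least two sides. -/
theorem not_sameSide_turn {d : C × ZMod 4} (hd : P.circle ∅ d = γ) :
    ¬ P.SameSide γ d (turn d) := by
  classical
  have : Nonempty C := ⟨d.1⟩
  have hsp : ∀ c, P.circle ∅ (c, 1) = P.circle ∅ (c, 0) ∧ P.circle ∅ (c, 3) = P.circle ∅ (c, 2) :=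
    fun c => ⟨P.circle_splice ∅ (c, 0), P.circle_splice ∅ (c, 2)⟩
  obtain ⟨g, hg, hg'⟩ := P.exists_coloring (fun x => if P.circle ∅ x = γ then 1 else 0)
    (fun x => by rw [circle_arc]) (fun c => by
      change ∑ i : Fin 4, (if P.circle ∅ (c, i) = γ then (1 : ZMod 2) else 0) = 0
      rw [Fin.sum_univ_four]
      have h1 := (hsp c).1
      have h3 := (hsp c).2
      change (if P.circle ∅ (c, 0) = γ then (1 : ZMod 2) else 0) +
        (if P.circle ∅ (c, 1) = γ then (1 : ZMod 2) else 0) +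
        (if P.circle ∅ (c, 2) = γ then (1 : ZMod 2) else 0) +
        (if P.circle ∅ (c, 3) = γ then (1 : ZMod 2) else 0) = 0
      rw [h1, h3]
      split_ifs <;> decide)
  have hinv : ∀ x y, P.SameSide γ x y → g x = g y := by
    intro x y h
    induction h with
    | rel x y h =>
      cases h with
      | region => exact (hg x).symm
      | channel c =>
        -- the channel is crossed by none of the two pieces of circles at `c`
        have e2 : g (c, 2) + g (c, 1) = _ := hg' (c, 2)
        have e3 : g (c, 3) + g (c, 2) = _ := hg' (c, 3)
        rw [(hsp c).2, ← e2] at e3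
        clear e2
        change g (c, 1) = g (c, 3)
        generalize g (c, 1) = p at *
        generalize g (c, 2) = q at *
        generalize g (c, 3) = r at *
        revert e3
        revert p q r
        decide
      | cross x h =>
        have e1 : g x + g (x.1, x.2 - 1) = _ := hg' x
        rw [if_neg h] at e1
        exact (ZMod.two_add_eq_zero_iff _ _).mp e1
    | refl => rfl
    | symm _ _ _ ih => exact ih.symm
    | trans _ _ _ _ _ ih ih' => exact ih.trans ih'
  intro h
  have e1 := hg' d
  rw [if_pos hd, (ZMod.two_add_eq_zero_iff _ _).mpr (hinv _ _ h)] at e1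
  exact absurd e1 (by decide)

variable {γ} in
theorem inside_congr {x y : C × ZMod 4} (h : P.SameSide γ x y) :
    P.Inside γ x ↔ P.Inside γ y :=
  forall₂_congr fun _ _ => not_congr
    ⟨fun h' => Relation.EqvGen.trans _ _ _ h' h, fun h' => Relation.EqvGen.trans _ _ _ h' h.symm⟩

/-- Jordan curve theorem: exactly one of the two sides of a circle is its inside. -/
theorem inside_turn_iff {d : C × ZMod 4} (hd : P.circle ∅ d = γ) :
    P.Inside γ (turn d) ↔ ¬ P.Inside γ d := by
  obtain ⟨o, ho⟩ := P.outer_region ⟨d.1⟩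
  have hins : ∀ x, P.Inside γ x ↔ ¬ P.SameSide γ o x := by
    intro x
    refine ⟨fun h => h o (by rw [ho]; rfl), fun h o' ho' h' => h ?_⟩
    rw [ho] at ho'
    have h1 := (Quot.eqvGen_exact ho').mono (p := P.Move γ) (by
      rintro x _ rfl
      exact Move.region x)
    exact SameSide.trans (SameSide.symm h1) h'
  rw [hins, hins, not_not]
  constructor
  · intro h
    exact ((P.sameSide_or γ hd o).resolve_right fun h' => h h'.symm).symm
  · intro h h'
    exact P.not_sameSide_turn γ hd (h.symm.trans h')

/-- The number of circles of the all-`A` state that the corner `x` is inside of. -/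
noncomputable def enclosing (x : C × ZMod 4) : ℕ := Set.ncard {γ | P.Inside γ x}

theorem enclosing_congr {x y : C × ZMod 4} (h : ∀ γ, P.SameSide γ x y) :
    P.enclosing x = P.enclosing y := by
  unfold enclosing
  congr 1
  ext γ
  exact P.inside_congr (h γ)

theorem depth_eq_ncard {d : C × ZMod 4} (hd : d = P.someDart γ ∨ d = turn (P.someDart γ)) :
    P.depth γ = Set.ncard ({γ' | P.Inside γ' d} \ {γ}) := by
  have hγ : P.circle ∅ (P.someDart γ) = γ := Quot.out_eq γ
  change Nat.card ({γ' | γ' ≠ γ ∧ P.Inside γ' (P.someDart γ)} : Set _) = _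
  rw [Nat.card_coe_set_eq]
  congr 1
  ext γ'
  simp only [Set.mem_ofPred_eq, Set.mem_sdiff, Set.mem_singleton_iff, and_comm (a := γ' ≠ γ)]
  refine and_congr_left fun hne => ?_
  rcases hd with rfl | rfl
  · rfl
  · exact P.inside_congr (P.sameSide_turn (by rw [hγ]; exact hne.symm))

theorem enclosing_eq_of_inside {d : C × ZMod 4} (hd : d = P.someDart γ ∨ d = turn (P.someDart γ))
    (h : P.Inside γ d) : P.enclosing d = P.depth γ + 1 := by
  rw [P.depth_eq_ncard γ hd]
  exact (Set.ncard_sdiff_singleton_add_one (s := {γ' | P.Inside γ' d}) h).symm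

theorem enclosing_eq_of_not_inside {d : C × ZMod 4}
    (hd : d = P.someDart γ ∨ d = turn (P.someDart γ)) (h : ¬ P.Inside γ d) :
    P.enclosing d = P.depth γ := by
  rw [P.depth_eq_ncard γ hd, Set.sdiff_singleton_eq_self (s := {γ' | P.Inside γ' d}) h]
  rfl

/-- The circles of the all-`A` state are oriented such that the corners to their left are inside an
odd number of circles, and the corners to their right inside an even number. -/
theorem odd_enclosing_orientedDart :
    Odd (P.enclosing (turn (P.orientedDart γ))) ∧ Even (P.enclosing (P.orientedDart γ)) := by
  have hγ : P.circle ∅ (P.someDart γ) = γ := Quot.out_eq γ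
  have hJ := P.inside_turn_iff γ hγ
  have hL : P.enclosing (turn (splice ∅ (P.someDart γ))) = P.enclosing (P.someDart γ) :=
    (P.enclosing_congr fun γ' => P.sameSide_splice_turn γ' _).symm
  have hR : P.enclosing (splice ∅ (P.someDart γ)) = P.enclosing (turn (P.someDart γ)) :=
    (P.enclosing_congr fun γ' => P.sameSide_turn_splice γ' _).symm
  have hc : P.Inside γ ((P.someDart γ).1, (P.someDart γ).2 - 1) =
    P.Inside γ (turn (P.someDart γ)) := rfl
  unfold orientedDart anticlockwiseDart
  rw [hc]
  by_cases h1 : P.Inside γ (turn (P.someDart γ))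
  · have e1 := P.enclosing_eq_of_inside γ (Or.inr rfl) h1
    have e2 := P.enclosing_eq_of_not_inside γ (Or.inl rfl) (hJ.mp h1)
    by_cases h2 : Even (P.depth γ)
    · rw [if_pos h2, if_pos h1, e1, e2]
      exact ⟨h2.add_one, h2⟩
    · rw [if_neg h2, if_pos h1, hL, hR, e1, e2]
      rw [Nat.not_even_iff_odd] at h2
      exact ⟨h2, h2.add_one⟩
  · have e1 := P.enclosing_eq_of_not_inside γ (Or.inr rfl) h1
    have e2 := P.enclosing_eq_of_inside γ (Or.inl rfl) (by
      by_contra h3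
      exact h1 (hJ.mpr h3))
    by_cases h2 : Even (P.depth γ)
    · rw [if_pos h2, if_neg h1, hL, hR, e1, e2]
      exact ⟨h2.add_one, h2⟩
    · rw [if_neg h2, if_neg h1, splice_splice, e1, e2]
      rw [Nat.not_even_iff_odd] at h2
      exact ⟨h2, h2.add_one⟩

theorem enclosing_turn_eq_of_sameCycle {d d' : C × ZMod 4} (h : P.travel.SameCycle d d') :
    P.enclosing (turn d) = P.enclosing (turn d') := by
  obtain ⟨n, rfl⟩ := h.exists_nat_pow_eq
  clear h
  induction n with
  | zero => rfl
  | succ n ih =>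
    rw [pow_succ', Equiv.Perm.mul_apply, ih]
    exact P.enclosing_congr fun γ => P.sameSide_turn_travel γ _

theorem entry_iff_odd_enclosing (d : C × ZMod 4) :
    P.Entry d ↔ Odd (P.enclosing (turn d)) := by
  have h1 := P.odd_enclosing_orientedDart (P.circle ∅ d)
  rcases (P.circle_eq_iff _ _).mp (P.circle_orientedDart (P.circle ∅ d)) with h | h
  · rw [P.enclosing_turn_eq_of_sameCycle h] at h1
    exact iff_of_true h h1.1
  · have h2 := P.enclosing_turn_eq_of_sameCycle h
    rw [← P.enclosing_congr fun γ' => P.sameSide_splice_turn γ' _] at h2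
    refine iff_of_false (fun h3 => ?_) ?_
    · exact P.not_sameCycle_splice _ (h3.trans h.symm)
    · rw [← h2, Nat.not_odd_iff_even]
      exact h1.2

/-- The oriented circles of the all-`A` state run along the channel of every crossing in opposite
directions. Hence the bands of the dessin are attached to them without a twist. -/
theorem entry_zero_iff_entry_two (c : C) : P.Entry (c, 0) ↔ P.Entry (c, 2) := by
  rw [entry_iff_odd_enclosing, entry_iff_odd_enclosing]
  have h := P.enclosing_congr fun γ =>
    (Relation.EqvGen.rel _ _ (Move.channel c) : P.SameSide γ (c, 1) (c, 3))
  have e0 : (turn (c, 0) : C × ZMod 4) = (c, 3) := rfl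
  have e2 : (turn (c, 2) : C × ZMod 4) = (c, 1) := rfl
  rw [e0, e2, h]

end ConnectedDiagram

/-! ### Cycles of permutations -/

section Cycles

variable {X : Type*} [Finite X]

/-- The cycles of a permutation, including the fixed points. -/
abbrev Cycles (τ : Equiv.Perm X) : Type _ := Quot (fun x y : X => y = τ x)

theorem cycles_mk_eq_iff (τ : Equiv.Perm X) (x y : X) :
    (Quot.mk _ x : Cycles τ) = Quot.mk _ y ↔ τ.SameCycle x y := by
  constructor
  · intro h
    have h' := Quot.eqvGen_exact h
    clear h
    induction h' with
    | rel x y h => exact ⟨1, h.symm⟩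
    | refl x => exact Equiv.Perm.SameCycle.refl _ _
    | symm _ _ _ ih => exact ih.symm
    | trans _ _ _ _ _ ih ih' => exact ih.trans ih'
  · intro h
    obtain ⟨n, rfl⟩ := h.exists_nat_pow_eq
    clear h
    induction n with
    | zero => rfl
    | succ n ih =>
      rw [ih, pow_succ', Equiv.Perm.mul_apply]
      exact Quot.sound rfl

/-- The cycles that meet `p` are the cycles of the first return permutation. -/
theorem card_cycles (τ : Equiv.Perm X) (p : X → Prop) :
    Nat.card (Cycles τ) = Nat.card (Cycles (firstReturn τ p)) +
      Nat.card {q : Cycles τ // ¬ ∃ x, p x ∧ Quot.mk _ x = q} := by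
  classical
  rw [← Nat.card_congr (Equiv.sumCompl fun q : Cycles τ => ∃ x, p x ∧ Quot.mk _ x = q),
    Nat.card_sum]
  congr 1
  have hiff : ∀ x y : {x // p x}, (Quot.mk _ x : Cycles (firstReturn τ p)) = Quot.mk _ y ↔
      (Quot.mk _ x.1 : Cycles τ) = Quot.mk _ y.1 := by
    intro x y
    rw [cycles_mk_eq_iff, cycles_mk_eq_iff, firstReturn_sameCycle]
  let F : Cycles (firstReturn τ p) → {q : Cycles τ // ∃ x, p x ∧ Quot.mk _ x = q} :=
    Quot.lift (fun x => ⟨Quot.mk _ x.1, x.1, x.2, rfl⟩) (by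
      rintro x _ rfl
      exact Subtype.ext ((hiff _ _).mp (Quot.sound rfl)))
  refine (Nat.card_congr (Equiv.ofBijective F ⟨?_, ?_⟩)).symm
  · intro a b h
    induction a using Quot.ind with
    | _ x =>
      induction b using Quot.ind with
      | _ y => exact (hiff x y).mpr (congrArg Subtype.val h)
  · rintro ⟨_, x, hx, rfl⟩
    exact ⟨Quot.mk _ ⟨x, hx⟩, rfl⟩

variable {σ τ : Equiv.Perm X} {p : X → Prop}

theorem firstReturn_eq_of_agree (h : ∀ x, ¬ p x → σ x = τ x) (x y : {x // p x})
    (hxy : σ x.1 = τ y.1) : firstReturn σ p x = firstReturn τ p y := by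
  classical
  have key : ∀ k, k ≤ Nat.find (exists_return τ p y) → (σ ^ (k + 1)) x.1 = (τ ^ (k + 1)) y.1 := by
    intro k hk
    induction k with
    | zero => simpa using hxy
    | succ k ih =>
      rw [pow_succ', Equiv.Perm.mul_apply, ih (by omega), pow_succ' τ (k + 1),
        Equiv.Perm.mul_apply]
      exact h _ (Nat.find_min (exists_return τ p y) hk)
  have hfind : Nat.find (exists_return σ p x) = Nat.find (exists_return τ p y) := by
    rw [Nat.find_eq_iff]
    refine ⟨?_, fun k hk => ?_⟩
    · rw [key _ le_rfl]
      exact Nat.find_spec (exists_return τ p y)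
    · rw [key k hk.le]
      exact Nat.find_min (exists_return τ p y) hk
  refine Subtype.ext ?_
  change (σ ^ (Nat.find (exists_return σ p x) + 1)) x.1 =
    (τ ^ (Nat.find (exists_return τ p y) + 1)) y.1
  rw [hfind, key _ le_rfl]

theorem sameCycle_iff_of_agree (h : ∀ x, ¬ p x → σ x = τ x) (x y : X)
    (hx : ∀ z, τ.SameCycle x z → ¬ p z) : σ.SameCycle x y ↔ τ.SameCycle x y := by
  have key : ∀ n : ℕ, (σ ^ n) x = (τ ^ n) x := by
    intro n
    induction n with
    | zero => rfl
    | succ n ih =>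
      rw [pow_succ', Equiv.Perm.mul_apply, ih, pow_succ', Equiv.Perm.mul_apply]
      exact h _ (hx _ ⟨n, rfl⟩)
  constructor
  · intro h'
    obtain ⟨n, rfl⟩ := h'.exists_nat_pow_eq
    exact ⟨n, (key n).symm⟩
  · intro h'
    obtain ⟨n, rfl⟩ := h'.exists_nat_pow_eq
    exact ⟨n, key n⟩

end Cycles

/-! ### The faces of a spanning sub-dessin -/

namespace Dessin

variable {V E : Type*}

open Classical in
/-- The involution that exchanges the two halves of the edges in `H`. -/
noncomputable def flipIn (H : Finset E) : Equiv.Perm (E × Bool) :=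
  Function.Involutive.toPerm (fun h => if h.1 ∈ H then flip h else h) (by
    intro h
    by_cases hh : h.1 ∈ H
    · have h2 : (flip h).1 ∈ H := hh
      simp only [hh, if_true, h2, flip_flip]
    · simp only [hh, if_false])

theorem flipIn_of_mem {H : Finset E} {h : E × Bool} (hh : h.1 ∈ H) : flipIn H h = flip h :=
  if_pos hh

theorem flipIn_of_notMem {H : Finset E} {h : E × Bool} (hh : h.1 ∉ H) : flipIn H h = h :=
  if_neg hh

/-- The boundary walk of the ribbon surface of the sub-dessin `H`, recorded at all half-edges of `D`:
it follows the edges in `H` and passes the others by. -/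
noncomputable def walk (D : Dessin V E) (H : Finset E) : Equiv.Perm (E × Bool) := D.rot * flipIn H

variable [Finite E] (D : Dessin V E) (H : Finset E)

theorem card_sub_boundary :
    Nat.card (Quot (fun h h' : {a // a ∈ H} × Bool => h' = (D.sub H).rot (flip h))) =
      Nat.card (Cycles (firstReturn (D.walk H) (fun h => h.1 ∈ H))) := by
  refine Nat.card_congr (Quot.congr
    (Equiv.prodSubtypeFstEquivSubtypeProd (p := fun a : E => a ∈ H)).symm fun h h' => ?_)
  rw [← (Equiv.prodSubtypeFstEquivSubtypeProd (p := fun a : E => a ∈ H)).symm.apply_eq_iff_eq]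
  refine Eq.congr rfl ?_
  simp only [sub, Equiv.permCongr_apply, Equiv.symm_apply_apply]
  refine firstReturn_eq_of_agree (p := fun h : E × Bool => h.1 ∈ H) (fun x hx => ?_) _ _ ?_
  · rw [walk, Equiv.Perm.mul_apply, flipIn_of_notMem hx]
  · rw [walk, Equiv.Perm.mul_apply, flipIn_of_mem h.1.2]
    rfl

/-- The boundary walks that meet no edge of `H` run around the vertices that become isolated
when the other edges are deleted. -/
theorem card_isolated_sub [Finite V] :
    Nat.card {x : V // x ∉ Set.range (D.sub H).vert} =
      Nat.card {q : Cycles (D.walk H) // ¬ ∃ h : E × Bool, h.1 ∈ H ∧ Quot.mk _ h = q} +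
      Nat.card {x : V // x ∉ Set.range D.vert} := by
  have hagree : ∀ h : E × Bool, ¬ h.1 ∈ H → D.rot h = D.walk H h := fun h hh => by
    rw [walk, Equiv.Perm.mul_apply, flipIn_of_notMem hh]
  have hmiss : ∀ h : E × Bool, (¬ ∃ h' : E × Bool, h'.1 ∈ H ∧ (Quot.mk _ h' : Cycles (D.walk H)) =
      Quot.mk _ h) → ∀ h', D.vert h = D.vert h' ↔ (D.walk H).SameCycle h h' := by
    intro h hh h'
    rw [← D.rot_sameCycle]
    exact sameCycle_iff_of_agree (p := fun h : E × Bool => h.1 ∈ H) hagree h h'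
      fun z hz hz' => hh ⟨z, hz', ((cycles_mk_eq_iff _ _ _).mpr hz).symm⟩
  have hmiss' : ∀ h : E × Bool, D.vert h ∉ Set.range (D.sub H).vert →
      ∀ h', D.vert h = D.vert h' ↔ (D.walk H).SameCycle h h' := by
    intro h hh h'
    rw [← D.rot_sameCycle]
    refine (sameCycle_iff_of_agree (p := fun h : E × Bool => h.1 ∈ H)
      (fun x hx => (hagree x hx).symm) h h' fun z hz hz' => hh ?_).symm
    exact ⟨(⟨z.1, hz'⟩, z.2), ((D.rot_sameCycle _ _).mp hz).symm⟩
  rw [← Nat.card_sum]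
  let F : {q : Cycles (D.walk H) // ¬ ∃ h : E × Bool, h.1 ∈ H ∧ Quot.mk _ h = q} ⊕
      {x : V // x ∉ Set.range D.vert} → {x : V // x ∉ Set.range (D.sub H).vert} :=
    Sum.elim
      (fun q => ⟨D.vert q.1.out, by
        rintro ⟨h, hh⟩
        refine q.2 ⟨(h.1.1, h.2), h.1.2, ?_⟩
        rw [← Quot.out_eq q.1, cycles_mk_eq_iff]
        refine ((hmiss q.1.out ?_ _).mp ?_).symm
        · rw [Quot.out_eq]
          exact q.2
        · exact hh.symm⟩)
      (fun x => ⟨x.1, fun ⟨h, hh⟩ => x.2 ⟨(h.1.1, h.2), hh⟩⟩)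
  refine (Nat.card_congr (Equiv.ofBijective F ⟨?_, ?_⟩)).symm
  · rintro (q | x) (q' | x') h
    · have h1 : D.vert q.1.out = D.vert q'.1.out := congrArg Subtype.val h
      rw [hmiss q.1.out (by rw [Quot.out_eq]; exact q.2), ← cycles_mk_eq_iff, Quot.out_eq,
        Quot.out_eq] at h1
      exact congrArg Sum.inl (Subtype.ext h1)
    · exact absurd ⟨_, congrArg Subtype.val h⟩ x'.2
    · exact absurd ⟨_, (congrArg Subtype.val h).symm⟩ x.2
    · have h1 : (F (Sum.inr x)).1 = (F (Sum.inr x')).1 := by rw [h]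
      exact congrArg Sum.inr (Subtype.ext h1)
  · rintro ⟨x, hx⟩
    by_cases hx' : x ∈ Set.range D.vert
    · obtain ⟨h, rfl⟩ := hx'
      have h1 := hmiss' h hx
      refine ⟨Sum.inl ⟨Quot.mk _ h, ?_⟩, Subtype.ext ?_⟩
      · rintro ⟨h', hh', hq⟩
        rw [cycles_mk_eq_iff] at hq
        exact hx ⟨(⟨h'.1, hh'⟩, h'.2), ((h1 h').mpr hq.symm).symm⟩
      · refine ((h1 _).mpr ?_).symm
        rw [← cycles_mk_eq_iff, Quot.out_eq]
    · exact ⟨Sum.inr ⟨x, hx'⟩, rfl⟩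

/-- The faces of the sub-dessin `H` are the boundary walks along it, and the isolated vertices. -/
theorem f_sub [Finite V] :
    (D.sub H).f = Nat.card (Cycles (D.walk H)) + Nat.card {x : V // x ∉ Set.range D.vert} := by
  have h1 : (D.sub H).f = Nat.card (Quot (fun h h' : {a // a ∈ H} × Bool =>
      h' = (D.sub H).rot (flip h))) + Nat.card {x : V // x ∉ Set.range (D.sub H).vert} :=
    Nat.card_sum
  rw [h1, card_sub_boundary, card_isolated_sub, card_cycles (D.walk H) (fun h => h.1 ∈ H)]
  ring

end Dessin

/-! ### The circles of a state are the faces of a spanning sub-dessin -/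

theorem splice_empty_apply {C : Type*} [DecidableEq C] (c : C) (i : ZMod 4) :
    splice ∅ (c, i) = (c, if i = 0 ∨ i = 2 then i + 1 else i - 1) := by
  change spliceFun ∅ (c, i) = _
  simp [spliceFun]

theorem splice_of_mem {C : Type*} [DecidableEq C] {H : Finset C} {c : C} (hc : c ∈ H) (i : ZMod 4) :
    splice H (c, i) = splice ∅ (c, i + 2) := by
  rw [splice_empty_apply]
  change spliceFun H (c, i) = _
  simp only [spliceFun, hc, if_true, Prod.mk.injEq, true_and]
  revert i
  decide

theorem splice_of_notMem {C : Type*} [DecidableEq C] {H : Finset C} {d : C × ZMod 4}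
    (hd : d.1 ∉ H) : splice H d = splice ∅ d := by
  change spliceFun H d = spliceFun ∅ d
  simp [spliceFun, hd]

namespace ConnectedDiagram

variable {C : Type*} [Fintype C] [DecidableEq C] (P : ConnectedDiagram C) (H : Finset C)

theorem entry_arc (d : C × ZMod 4) : P.Entry (P.arc d) ↔ ¬ P.Entry d := by
  rw [← entry_splice, entry_travel P (splice ∅ d), travel, Equiv.Perm.mul_apply, splice_splice]

theorem entry_add_two (c : C) (i : ZMod 4) : P.Entry (c, i + 2) ↔ P.Entry (c, i) := by
  have h1 := P.entry_splice (c, 0)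
  have h2 := P.entry_splice (c, 2)
  have h3 := P.entry_zero_iff_entry_two c
  rw [splice_empty_apply] at h1 h2
  change P.Entry (c, 1) ↔ _ at h1
  change P.Entry (c, 3) ↔ _ at h2
  fin_cases i
  · exact h3.symm
  · change P.Entry (c, 3) ↔ P.Entry (c, 1)
    rw [h1, h2, h3]
  · exact h3
  · change P.Entry (c, 1) ↔ P.Entry (c, 3)
    rw [h1, h2, h3]

theorem entry_splice_iff (d : C × ZMod 4) : P.Entry (splice H d) ↔ ¬ P.Entry d := by
  obtain ⟨c, i⟩ := d
  by_cases hc : c ∈ H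
  · rw [splice_of_mem hc, entry_splice, entry_add_two]
  · rw [splice_of_notMem hc, entry_splice]

theorem entry_arc_splice {d : C × ZMod 4} (hd : P.Entry d) : P.Entry (P.arc (splice H d)) := by
  rw [entry_arc, entry_splice_iff, not_not]
  exact hd

/-- The boundary walk along the sub-dessin `H` is the walk along the circles of the state `H`. -/
theorem walk_entryEquiv (d : C × ZMod 4) (hd : P.Entry d) :
    P.dessin.walk H (P.entryEquiv ⟨d, hd⟩) =
      P.entryEquiv ⟨P.arc (splice H d), P.entry_arc_splice H hd⟩ := by
  have hrot : ∀ (d : C × ZMod 4) (hd : P.Entry d), P.dessin.rot (P.entryEquiv ⟨d, hd⟩) =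
      P.entryEquiv ⟨P.travel d, (P.entry_travel d).mp hd⟩ := by
    intro d hd
    simp only [dessin, Equiv.permCongr_apply, Equiv.symm_apply_apply]
    rfl
  obtain ⟨c, i⟩ := d
  rw [Dessin.walk, Equiv.Perm.mul_apply]
  by_cases hc : c ∈ H
  · have h1 : Dessin.flipIn H (P.entryEquiv ⟨(c, i), hd⟩) =
        P.entryEquiv ⟨(c, i + 2), (P.entry_add_two c i).mpr hd⟩ := by
      rw [Dessin.flipIn_of_mem (by exact hc)]
      change Dessin.flip (piece (c, i)) = piece (c, i + 2)
      simp only [Dessin.flip, piece, Prod.mk.injEq, true_and]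
      have key : ∀ i : ZMod 4,
          (!decide (i = 2 ∨ i = 3)) = decide (i + 2 = 2 ∨ i + 2 = 3) := by decide
      exact key i
    rw [h1, hrot]
    congr 1
    exact Subtype.ext (congrArg P.arc (splice_of_mem hc i).symm)
  · rw [Dessin.flipIn_of_notMem (by exact hc), hrot]
    congr 1
    exact Subtype.ext (congrArg P.arc (splice_of_notMem (d := (c, i)) hc).symm)

open Classical in
/-- The dart of entry among the two ends `d` and `splice H d` of a piece of a circle of the state
`H`, as a half-edge. -/
noncomputable def entryHalf (d : C × ZMod 4) : C × Bool :=
  if hd : P.Entry d then P.entryEquiv ⟨d, hd⟩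
  else P.entryEquiv ⟨splice H d, (P.entry_splice_iff H d).mpr hd⟩

theorem entryHalf_splice (d : C × ZMod 4) :
    P.entryHalf H (splice H d) = P.entryHalf H d := by
  unfold entryHalf
  by_cases hd : P.Entry d
  · have h1 : ¬ P.Entry (splice H d) := by
      rw [entry_splice_iff, not_not]
      exact hd
    simp only [hd, h1, dif_pos, dif_neg, not_false_eq_true, splice_splice]
  · have h1 : P.Entry (splice H d) := (P.entry_splice_iff H d).mpr hd
    simp only [hd, h1, dif_pos, dif_neg, not_false_eq_true]

theorem entryHalf_arc {d : C × ZMod 4} (hd : ¬ P.Entry d) :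
    P.entryHalf H (P.arc d) = P.dessin.walk H (P.entryHalf H d) := by
  have h1 : P.Entry (P.arc d) := (P.entry_arc d).mpr hd
  unfold entryHalf
  simp only [hd, h1, dif_pos, dif_neg, not_false_eq_true, walk_entryEquiv, splice_splice]

theorem circle_walk (h : C × Bool) :
    P.circle H (P.entryEquiv.symm (P.dessin.walk H h)).1 = P.circle H (P.entryEquiv.symm h).1 := by
  obtain ⟨⟨d, hd⟩, rfl⟩ := P.entryEquiv.surjective h
  rw [walk_entryEquiv, Equiv.symm_apply_apply, Equiv.symm_apply_apply, circle_arc, circle_splice]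

/-- The circles of the state `H` that pass through crossings are the boundary walks along the
sub-dessin `H`. -/
noncomputable def circleEquiv : P.Circle H ≃ Cycles (P.dessin.walk H) where
  toFun := Quot.lift (fun d => Quot.mk _ (P.entryHalf H d)) (by
    rintro d _ (rfl | rfl)
    · by_cases hd : P.Entry d
      · have h1 := P.entryHalf_arc H (d := P.arc d) (by rwa [entry_arc, not_not])
        rw [P.arc_arc] at h1
        exact (Quot.sound (r := fun x y => y = P.dessin.walk H x) h1).symm
      · exact Quot.sound (P.entryHalf_arc H hd)
    · rw [entryHalf_splice])
  invFun := Quot.lift (fun h => P.circle H (P.entryEquiv.symm h).1) (by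
    rintro h _ rfl
    exact (P.circle_walk H h).symm)
  left_inv := by
    intro a
    induction a using Quot.ind with
    | _ d =>
      change P.circle H (P.entryEquiv.symm (P.entryHalf H d)).1 = P.circle H d
      unfold entryHalf
      by_cases hd : P.Entry d
      · rw [dif_pos hd, Equiv.symm_apply_apply]
      · rw [dif_neg hd, Equiv.symm_apply_apply, circle_splice]
  right_inv := by
    intro a
    induction a using Quot.ind with
    | _ h =>
      change (Quot.mk _ (P.entryHalf H (P.entryEquiv.symm h).1) : Cycles (P.dessin.walk H)) = _
      rw [entryHalf, dif_pos (P.entryEquiv.symm h).2]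
      exact congrArg _ (P.entryEquiv.apply_symm_apply h)

theorem card_isolated_dessin :
    Nat.card {x : P.StateCircle ∅ // x ∉ Set.range P.dessin.vert} =
      Nat.card (PLift (IsEmpty C)) := by
  refine (Nat.card_congr (Equiv.ofBijective
    (fun x => ⟨Sum.inr x, fun ⟨h, hh⟩ => Sum.inl_ne_inr hh⟩) ⟨?_, ?_⟩)).symm
  · intro x y h
    exact Sum.inr_injective (congrArg Subtype.val h)
  · rintro ⟨γ | x, hx⟩
    · refine absurd ?_ hx
      refine ⟨piece (P.someDart γ), congrArg Sum.inl ?_⟩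
      exact (P.circle_piece _).trans (Quot.out_eq γ)
    · exact ⟨x, rfl⟩

theorem card_stateCircle : Nat.card (P.StateCircle H) = (P.dessin.sub H).f := by
  rw [Dessin.f_sub, card_isolated_dessin, ← Nat.card_congr (P.circleEquiv H)]
  exact Nat.card_sum

end ConnectedDiagram

/-! ### Coefficients of the contributions -/

section Coefficients

open LaurentPolynomial

theorem coeff_mul_T (p : LaurentPolynomial ℤ) (n m : ℤ) : (p * T n).coeff m = p.coeff (m - n) := by
  have h := AddMonoidAlgebra.coeff_mul_single_eq_coeff_mul (x := p) (m := n) (m₁ := m) (r := (1 : ℤ))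
    (m - n) (fun m' _ => by omega)
  rwa [mul_one] at h

theorem coeff_mul_loopValue (p : LaurentPolynomial ℤ) (m : ℤ) :
    (p * (-T 2 - T (-2))).coeff m = -p.coeff (m - 2) - p.coeff (m + 2) := by
  have h1 : p * (-T 2 - T (-2)) = -(p * T 2) - p * T (-2) := by ring
  rw [h1]
  change -(p * T 2).coeff m - (p * T (-2)).coeff m = _
  rw [coeff_mul_T, coeff_mul_T, sub_neg_eq_add]

theorem coeff_loopValue_pow_eq_zero (n : ℕ) (m : ℤ) (h : 2 * (n : ℤ) < m) :
    ((-T 2 - T (-2) : LaurentPolynomial ℤ) ^ n).coeff m = 0 := by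
  induction n generalizing m with
  | zero =>
    rw [pow_zero, ← T_zero, T_apply, if_neg]
    push_cast at h
    omega
  | succ n ih =>
    push_cast at h
    rw [pow_succ, coeff_mul_loopValue, ih _ (by omega), ih _ (by omega)]
    rfl

theorem coeff_loopValue_pow_top (n : ℕ) :
    ((-T 2 - T (-2) : LaurentPolynomial ℤ) ^ n).coeff (2 * (n : ℤ)) = (-1) ^ n := by
  induction n with
  | zero =>
    rw [pow_zero, ← T_zero, T_apply, if_pos (by simp), pow_zero]
  | succ n ih =>
    rw [pow_succ, coeff_mul_loopValue,
      coeff_loopValue_pow_eq_zero n (2 * ((n + 1 : ℕ) : ℤ) + 2) (by push_cast; omega)]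
    have h1 : 2 * ((n + 1 : ℕ) : ℤ) - 2 = 2 * (n : ℤ) := by push_cast; ring
    rw [h1, ih, pow_succ]
    ring

end Coefficients

namespace Dessin

variable {V E : Type*}

theorem f_pos [Finite V] [Finite E] [Nonempty V] (D : Dessin V E) : 0 < D.f := by
  have : Nonempty D.Face := by
    obtain ⟨x⟩ := ‹Nonempty V›
    by_cases hx : x ∈ Set.range D.vert
    · exact ⟨D.face hx.choose⟩
    · exact ⟨Sum.inr ⟨x, hx⟩⟩
  exact Nat.card_pos

theorem k_le_v [Finite V] (D : Dessin V E) : D.k ≤ D.v :=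
  Nat.card_le_card_of_surjective (Quot.mk _) Quot.mk_surjective

/-- A dessin with as many components as vertices has only loops. -/
theorem isLoop_of_k_eq_v [Finite V] (D : Dessin V E) (h : D.k = D.v) (a : E) : D.IsLoop a := by
  have h1 : Function.Bijective (Quot.mk _ : V → D.Component) :=
    Quot.mk_surjective.bijective_of_nat_card_le h.ge
  exact h1.1 (Quot.sound ⟨a, rfl, rfl⟩)

theorem e_sub [Finite E] (D : Dessin V E) (H : Finset E) : (D.sub H).e = H.card := by
  simp [e]

theorem k_eq_v_of_isEmpty [IsEmpty E] (D : Dessin V E) : D.k = D.v := by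
  let F : D.Component → V := Quot.lift id (by
    rintro _ _ ⟨a, _⟩
    exact isEmptyElim a)
  refine (Nat.card_congr (Equiv.ofBijective (Quot.mk _ : V → D.Component)
    ⟨fun x y h => congrArg F h, Quot.mk_surjective⟩)).symm

theorem f_eq_v_of_isEmpty [IsEmpty E] (D : Dessin V E) : D.f = D.v :=
  Nat.card_congr ((Equiv.emptySum _ _).trans (Equiv.subtypeUnivEquiv
    fun _ ⟨h, _⟩ => isEmptyElim h))

theorem genus_of_isEmpty [IsEmpty E] (D : Dessin V E) : D.genus = 0 := by
  have he : D.e = 0 := Nat.card_of_isEmpty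
  rw [genus, D.k_eq_v_of_isEmpty, D.f_eq_v_of_isEmpty, he]
  push_cast
  ring

theorem Iso.v_eq {V' E' : Type*} {D : Dessin V E} {D' : Dessin V' E'} (φ : D.Iso D') :
    D.v = D'.v :=
  Nat.card_congr φ.vertEquiv

theorem Iso.e_eq {V' E' : Type*} {D : Dessin V E} {D' : Dessin V' E'} (φ : D.Iso D') :
    D.e = D'.e := by
  have h := Nat.card_congr φ.halfEquiv
  rw [Nat.card_prod, Nat.card_prod, Nat.card_eq_fintype_card (α := Bool), Fintype.card_bool] at h
  exact Nat.eq_of_mul_eq_mul_right two_pos h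

theorem Iso.f_eq {V' E' : Type*} {D : Dessin V E} {D' : Dessin V' E'} (φ : D.Iso D') :
    D.f = D'.f := by
  refine Nat.card_congr (Equiv.sumCongr (Quot.congr φ.halfEquiv fun h h' => ?_)
    (φ.vertEquiv.subtypeEquiv fun x => not_congr ?_))
  · rw [← φ.halfEquiv.apply_eq_iff_eq, φ.map_rot, φ.map_flip]
  · constructor
    · rintro ⟨h, rfl⟩
      exact ⟨φ.halfEquiv h, φ.map_vert h⟩
    · rintro ⟨h', hh⟩
      obtain ⟨h, rfl⟩ := φ.halfEquiv.surjective h'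
      exact ⟨h, φ.vertEquiv.injective (by rw [← φ.map_vert, hh])⟩

variable [Finite E] (D : Dessin V E) (H : Finset E)

open LaurentPolynomial in
theorem coeff_contribution (l : ℤ) :
    (D.contribution H).coeff ((D.e : ℤ) + 2 * D.v - 2 - 4 * l) =
      ((-T 2 - T (-2) : LaurentPolynomial ℤ) ^ ((D.sub H).f - 1)).coeff
        (2 * (((D.sub H).v : ℤ) + (D.sub H).e - 1 - 2 * l)) := by
  have hv : D.v = (D.sub H).v := rfl
  rw [contribution, mul_comm, coeff_mul_T, hv]
  congr 1
  ring

variable [Finite V] [Nonempty V]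

/-- The highest exponent in the contribution of `H` is
`e(D) + 2 v(D) - 2 - 4 (v(D) - k(H)) - 4 g(H)`. -/
theorem coeff_contribution_eq_zero {l : ℤ}
    (h : (l : ℚ) < ((D.sub H).v - (D.sub H).k : ℚ) + (D.sub H).genus) :
    (D.contribution H).coeff ((D.e : ℤ) + 2 * D.v - 2 - 4 * l) = 0 := by
  rw [coeff_contribution]
  apply coeff_loopValue_pow_eq_zero
  have h0 := (D.sub H).f_pos
  have h1 : ((D.sub H).f : ℚ) + 2 * l < (D.sub H).v + (D.sub H).e := by
    unfold genus at h
    linarith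
  have h2 : ((D.sub H).f : ℤ) + 2 * l < (D.sub H).v + (D.sub H).e := by exact_mod_cast h1
  omega

theorem coeff_contribution_top (hg : (D.sub H).genus = 0) (hk : (D.sub H).k = D.v) :
    (D.contribution H).coeff ((D.e : ℤ) + 2 * D.v - 2 - 4 * 0) =
      (-1) ^ (D.v + (D.sub H).e - 1) := by
  have hv : (D.sub H).v = D.v := rfl
  have h0 := (D.sub H).f_pos
  have h1 : ((D.sub H).f : ℚ) = D.v + (D.sub H).e := by
    unfold genus at hg
    rw [hk, hv] at hg
    linarith
  have h2 : (D.sub H).f = D.v + (D.sub H).e := by exact_mod_cast h1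
  rw [coeff_contribution, hv, ← coeff_loopValue_pow_top, h2]
  congr 1
  omega

end Dessin

/-! ### The expansion of the Kauffman bracket -/

namespace ConnectedDiagram

variable {C : Type*} [Fintype C] [DecidableEq C] (P : ConnectedDiagram C)

instance : Nonempty (P.StateCircle ∅) := by
  rcases isEmpty_or_nonempty C with h | ⟨⟨c⟩⟩
  · exact ⟨Sum.inr ⟨h⟩⟩
  · exact ⟨Sum.inl (P.circle ∅ (c, 0))⟩

/-- The spanning sub-dessin expansion of the Kauffman bracket. -/
theorem bracket_eq_sum_contribution : P.bracket = ∑ H : Finset C, P.dessin.contribution H := by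
  refine Finset.sum_congr rfl fun H _ => ?_
  have he : P.dessin.e = Fintype.card C := Nat.card_eq_fintype_card
  have h1 := Finset.card_add_card_compl H
  rw [Dessin.contribution, card_stateCircle, Dessin.e_sub, he, ← h1]
  congr 2
  push_cast
  ring

theorem a_eq_sum (l : ℕ) : P.a l = ∑ H : Finset C,
    (P.dessin.contribution H).coeff (P.topExponent - 4 * (l : ℤ)) := by
  rw [a, bracket_eq_sum_contribution, AddMonoidAlgebra.coeff_sum, Finset.sum_apply']

theorem coeff_contribution_eq_zero_of_lt_genus (l : ℕ) (H : Finset C)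
    (h : (l : ℚ) < (P.dessin.sub H).genus) :
    (P.dessin.contribution H).coeff (P.topExponent - 4 * (l : ℤ)) = 0 := by
  apply Dessin.coeff_contribution_eq_zero
  have h1 : ((P.dessin.sub H).k : ℚ) ≤ (P.dessin.sub H).v := by
    exact_mod_cast (P.dessin.sub H).k_le_v
  push_cast
  linarith

theorem a_eq_sum_genus_le (l : ℕ) : P.a l = ∑ H : Finset C with (P.dessin.sub H).genus ≤ l,
    (P.dessin.contribution H).coeff (P.topExponent - 4 * (l : ℤ)) := by
  rw [a_eq_sum, Finset.sum_filter_of_ne]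
  intro H _ h
  by_contra h'
  exact h (P.coeff_contribution_eq_zero_of_lt_genus l H (not_le.mp h'))

theorem coeff_contribution_topExponent_eq_zero (H : Finset C)
    (h : ¬ ((P.dessin.sub H).genus = 0 ∧ (P.dessin.sub H).k = P.dessin.v)) :
    (P.dessin.contribution H).coeff (P.topExponent - 4 * (0 : ℤ)) = 0 := by
  apply Dessin.coeff_contribution_eq_zero
  have hv : P.dessin.v = (P.dessin.sub H).v := rfl
  have h0 := (P.dessin.sub H).genus_nonneg
  have h1 := (P.dessin.sub H).k_le_v
  rw [hv] at h
  rcases h1.lt_or_eq with h2 | h2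
  · have h3 : ((P.dessin.sub H).k : ℚ) < (P.dessin.sub H).v := by exact_mod_cast h2
    push_cast
    linarith
  · have h3 := lt_of_le_of_ne h0 fun h4 => h ⟨h4.symm, h2⟩
    rw [h2]
    push_cast
    linarith

theorem a_zero_eq_sum : P.a 0 = ∑ H : Finset C with
    (P.dessin.sub H).genus = 0 ∧ (P.dessin.sub H).k = P.dessin.v,
      (-1 : ℤ) ^ (P.dessin.v + (P.dessin.sub H).e - 1) := by
  rw [a_eq_sum, Finset.sum_filter]
  refine Finset.sum_congr rfl fun H _ => ?_
  split_ifs with h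
  · exact P.dessin.coeff_contribution_top H h.1 h.2
  · exact P.coeff_contribution_topExponent_eq_zero H h

theorem a_eq_of_iso {C' : Type*} [Fintype C'] [DecidableEq C'] (P' : ConnectedDiagram C') (l : ℕ)
    (ψ : {H : Finset C // (P.dessin.sub H).genus ≤ l} ≃
      {H' : Finset C' // (P'.dessin.sub H').genus ≤ l})
    (h : ∀ H, Nonempty ((P.dessin.sub H.1).Iso (P'.dessin.sub (ψ H).1))) : P.a l = P'.a l := by
  rw [a_eq_sum_genus_le, a_eq_sum_genus_le]
  have hF : ∀ H, H ∈ Finset.univ.filter (fun H => (P.dessin.sub H).genus ≤ l) ↔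
      (P.dessin.sub H).genus ≤ l := fun H => by simp
  have hF' : ∀ H, H ∈ Finset.univ.filter (fun H => (P'.dessin.sub H).genus ≤ l) ↔
      (P'.dessin.sub H).genus ≤ l := fun H => by simp
  rw [Finset.sum_subtype _ hF, Finset.sum_subtype _ hF']
  refine Fintype.sum_equiv ψ _ _ fun H => ?_
  obtain ⟨φ⟩ := h H
  rw [topExponent, topExponent, Dessin.coeff_contribution, Dessin.coeff_contribution, φ.f_eq,
    φ.v_eq, φ.e_eq]

theorem genus_eq_zero_and_k_eq_v_iff (hP : ∀ c, ¬ P.dessin.IsLoop c) (H : Finset C) :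
    (P.dessin.sub H).genus = 0 ∧ (P.dessin.sub H).k = P.dessin.v ↔ H = ∅ := by
  constructor
  · rintro ⟨_, hk⟩
    rw [Finset.eq_empty_iff_forall_notMem]
    intro c hc
    exact hP c ((P.dessin.sub H).isLoop_of_k_eq_v hk ⟨c, hc⟩)
  · rintro rfl
    exact ⟨Dessin.genus_of_isEmpty _, Dessin.k_eq_v_of_isEmpty _⟩

end ConnectedDiagram

theorem mainTheorem4 {C : Type*} [Fintype C] [DecidableEq C] (P : ConnectedDiagram C) :
    -- only the sub-dessins of genus at most `l` contribute to `a_{M-l}`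
    (∀ l : ℕ,
      (P.a l = ∑ H : Finset C with (P.dessin.sub H).genus ≤ l,
        (P.dessin.contribution H).coeff (P.topExponent - 4 * (l : ℤ))) ∧
      ∀ H : Finset C, (l : ℚ) < (P.dessin.sub H).genus →
        (P.dessin.contribution H).coeff (P.topExponent - 4 * (l : ℤ)) = 0) ∧
    -- hence `a_{M-l}` is determined by them: if the sub-dessins of genus at most `l` of two diagrams correspond to
    -- each other up to isomorphism, then `a_{M-l}` is the same for both diagrams
    (∀ {C' : Type*} [Fintype C'] [DecidableEq C'] (P' : ConnectedDiagram C') (l : ℕ)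
      (ψ : {H : Finset C // (P.dessin.sub H).genus ≤ l} ≃
        {H' : Finset C' // (P'.dessin.sub H').genus ≤ l}),
      (∀ H, Nonempty ((P.dessin.sub H.1).Iso (P'.dessin.sub (ψ H).1))) → P.a l = P'.a l) ∧
    -- the highest term, and the case without loops
    (P.a 0 = ∑ H : Finset C with (P.dessin.sub H).genus = 0 ∧ (P.dessin.sub H).k = P.dessin.v,
        (-1 : ℤ) ^ (P.dessin.v + (P.dessin.sub H).e - 1)) ∧
    ((∀ c : C, ¬ P.dessin.IsLoop c) →
      P.a 0 = (-1 : ℤ) ^ (P.dessin.v - 1) ∧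
      (∀ H : Finset C,
        (P.dessin.sub H).genus = 0 ∧ (P.dessin.sub H).k = P.dessin.v ↔ H = ∅) ∧
      ∀ H : Finset C, H ≠ ∅ → (P.dessin.contribution H).coeff P.topExponent = 0) := by
  refine ⟨fun l => ⟨P.a_eq_sum_genus_le l, P.coeff_contribution_eq_zero_of_lt_genus l⟩,
    fun P' l ψ h => P.a_eq_of_iso P' l ψ h, P.a_zero_eq_sum, fun hP => ?_⟩
  have hiff := P.genus_eq_zero_and_k_eq_v_iff hP
  refine ⟨?_, hiff, fun H hH => ?_⟩
  · rw [P.a_zero_eq_sum]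
    simp only [hiff, Finset.sum_filter, Finset.sum_ite_eq', Finset.mem_univ, if_true,
      Dessin.e_sub, Finset.card_empty, add_zero]
  · have h := P.coeff_contribution_topExponent_eq_zero H fun h => hH ((hiff H).mp h)
    rwa [mul_zero, sub_zero] at h
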